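/- Let $Q$ be a finite quiver without loops and without oriented 2-cycles, with vertex set $Q_0$. Let $\mathcal{A}_Q\subset\mathbb{Q}(x_v : v\in Q_0)$ be its cluster algebra, i.e. the $\mathbb{Z}$-subalgebra generated by all cluster variables, that is, by all elements of all clusters obtained by finite sequences of mutations from the initial seed $\bigl(Q,(x_v)_{v\in Q_0}\bigr)$. Suppose that $Q$ has no multiple arrows and no isolated vertices, and let $A\subseteq Q_0$ be a set of vertices whose neighbourhoods are pairwise disjoint, where the neighbourhood of a vertex consists of the vertex itself and all vertices joined to it by an arrow in either direction. Then every element of $\mathcal{A}_Q$ is a Laurent polynomial with integer coefficients in the variables $x_v$ ($v\in Q_0$), so that the $x_v$ can be specialised to $\pm1$ in it, and there is a labelling $\sigma : Q_0\setminus A\to\{1,-1\}$ that makes every vertex of $A$ polyamorous. The latter means the following. Let $\mathcal{A}_Q|_\sigma\subseteq\mathbb{Z}[x_v^{\pm1} : v\in A]$ be the specialised cluster algebra, obtained from $\mathcal{A}_Q$ by substituting $x_w=\sigma(w)$ for all $w\in Q_0\setminus A$. Then, for every $v\in A$, each element of $\mathcal{A}_Q|_\sigma$ is polynomial in $x_v$,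 i.e. contains no negative power of $x_v$. -/

import Mathlib

/-- A quiver without loops and without oriented 2-cycles. -/
structure IsClusterQuiver (V : Type*) [Quiver V] : Prop where
  no_loops : ∀ i : V, IsEmpty (i ⟶ i)
  no_two_cycles : ∀ i j : V, IsEmpty (i ⟶ j) ∨ IsEmpty (j ⟶ i)

/-- Two vertices of a quiver are adjacent if some arrow, in either direction, joins them. -/
def QuiverAdjacent {V : Type*} [Quiver V] (v w : V) : Prop :=
  Nonempty (v ⟶ w) ∨ Nonempty (w ⟶ v)

/-- The neighbourhood of a vertex: the vertex itself and all vertices adjacent to it. -/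
def quiverNeighbourhood {V : Type*} [Quiver V] (v : V) : Set V :=
  {w | w = v ∨ QuiverAdjacent v w}

/-- The ring `ℤ[x_v, x_v⁻¹ : v ∈ V]` of Laurent polynomials with integer coefficients; the
exponent vector `m : V → ℤ` stands for the monomial `∏ v, x_v ^ m v` (`V` is finite in all
uses). -/
abbrev MvLaurent (V : Type*) : Type _ := AddMonoidAlgebra ℤ (V → ℤ)

namespace MvLaurent

variable {V : Type*}

/-- The Laurent monomial with exponent vector `m`, as a unit. -/
noncomputable def monomialUnit (m : V → ℤ) : (MvLaurent V)ˣ where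
  val := AddMonoidAlgebra.single m 1
  inv := AddMonoidAlgebra.single (-m) 1
  val_inv := by
    rw [AddMonoidAlgebra.single_mul_single, add_neg_cancel, one_mul]; rfl
  inv_val := by
    rw [AddMonoidAlgebra.single_mul_single, neg_add_cancel, one_mul]; rfl

/-- The variable `x_v`, which is a unit of the Laurent polynomial ring. -/
noncomputable def var [DecidableEq V] (v : V) : (MvLaurent V)ˣ :=
  monomialUnit (Pi.single v 1)

/-- Substitution of units `u v` of a commutative ring for the variables `x_v`. -/
noncomputable def eval [Fintype V] {R : Type*} [CommRing R] (u : V → Rˣ) :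
    MvLaurent V →ₐ[ℤ] R :=
  AddMonoidAlgebra.lift ℤ R (V → ℤ)
    { toFun := fun m => ((∏ v, u v ^ (Multiplicative.toAdd m) v : Rˣ) : R)
      map_one' := by simp
      map_mul' := fun m n => by
        simp only [toAdd_mul, Pi.add_apply, zpow_add, Finset.prod_mul_distrib, Units.val_mul] }

/-- `f` is polynomial in the variable `x_v`: no negative power of `x_v` occurs in `f`. (The other
variables may occur with negative exponents.) -/
def IsPolynomialIn (v : V) (f : MvLaurent V) : Prop :=
  ∀ m : V → ℤ, f.coeff m ≠ 0 → 0 ≤ m v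

end MvLaurent

/-- The field `ℚ(x_v : v ∈ V)` of rational functions, as the field of fractions of
`ℤ[x_v, x_v⁻¹ : v ∈ V]`. -/
abbrev RationalFunctionField (V : Type*) [Finite V] : Type _ := FractionRing (MvLaurent V)

/-- A seed: a quiver on `V`, given by the number `arrows i j` of arrows `i → j`, together with a
cluster, i.e. a family of elements of a field indexed by `V`. -/
structure Seed (V : Type*) (F : Type*) where
  arrows : V → V → ℕ
  cluster : V → F

/-- Mutation of a seed at `j`. On the quiver: the arrows incident to `j` are reversed, every
2-path `i → j → k` of the original quiver contributes one arrow `i → k`, and the resulting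
oriented 2-cycles are cancelled (truncated subtraction). On the cluster: `x_j` is replaced by
`(∏_{i → j} x_i + ∏_{j → i} x_i) / x_j`, the products being over arrows. -/
def Seed.mutate {V : Type*} [Fintype V] [DecidableEq V] {F : Type*} [Field F]
    (j : V) (s : Seed V F) : Seed V F where
  arrows := fun i k =>
    if i = j ∨ k = j then s.arrows k i
    else (s.arrows i k + s.arrows i j * s.arrows j k) -
      (s.arrows k i + s.arrows k j * s.arrows j i)
  cluster := Function.update s.cluster j
    ((∏ i, s.cluster i ^ s.arrows i j + ∏ i, s.cluster i ^ s.arrows j i) / s.cluster j)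

/-- The seeds obtained from the seed `s₀` by finite sequences of mutations. -/
inductive Seed.Reachable {V : Type*} [Fintype V] [DecidableEq V] {F : Type*} [Field F]
    (s₀ : Seed V F) : Seed V F → Prop
  | refl : Seed.Reachable s₀ s₀
  | mutate (s : Seed V F) (j : V) : Seed.Reachable s₀ s → Seed.Reachable s₀ (s.mutate j)

section ClusterAlgebra

variable (V : Type*) [Fintype V] [DecidableEq V] [Quiver V]

/-- The initial seed of a finite quiver: the quiver itself with the cluster `(x_v)`. -/
noncomputable def initialSeed : Seed V (RationalFunctionField V) where
  arrows := fun i j => Nat.card (i ⟶ j)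
  cluster := fun v =>
    algebraMap (MvLaurent V) (RationalFunctionField V) (MvLaurent.var v : MvLaurent V)

/-- The cluster variables of the cluster algebra of a finite quiver. -/
def clusterVariables : Set (RationalFunctionField V) :=
  {y | ∃ s : Seed V (RationalFunctionField V), (initialSeed V).Reachable s ∧ ∃ v, y = s.cluster v}

/-- The cluster algebra of a finite quiver: the `ℤ`-algebra generated by all cluster variables. -/
noncomputable def clusterAlgebra : Subalgebra ℤ (RationalFunctionField V) :=
  Algebra.adjoin ℤ (clusterVariables V)

/-- The inclusion of the Laurent polynomials into the rational functions. -/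
noncomputable def laurentInclusion : MvLaurent V →ₐ[ℤ] RationalFunctionField V :=
  IsScalarTower.toAlgHom ℤ (MvLaurent V) (RationalFunctionField V)

variable {V}

/-- A partial labelling of the vertices by `1` and `-1` (the elements of `ℤˣ`); `none` means that
the vertex is not labelled. -/
abbrev PartialLabelling (V : Type*) : Type _ := V → Option ℤˣ

/-- The value substituted for `x_v`: the label of `v` if there is one, and `x_v` otherwise. -/
noncomputable def PartialLabelling.value (σ : PartialLabelling V) (v : V) :
    (MvLaurent {w : V // σ w = none})ˣ :=
  match h : σ v with
  | none => MvLaurent.var ⟨v, h⟩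
  | some a => Units.map (algebraMap ℤ (MvLaurent {w : V // σ w = none})).toMonoidHom a

/-- The specialisation of Laurent polynomials determined by a partial labelling; its values are
Laurent polynomials in the variables that are not labelled. -/
noncomputable def PartialLabelling.specialise (σ : PartialLabelling V) :
    MvLaurent V →ₐ[ℤ] MvLaurent {w : V // σ w = none} :=
  MvLaurent.eval σ.value

/-- The specialised cluster algebra: all specialisations of elements of the cluster algebra,
these elements being regarded as Laurent polynomials in the initial cluster variables. -/
noncomputable def specialisedClusterAlgebra (σ : PartialLabelling V) :
    Subalgebra ℤ (MvLaurent {w : V // σ w = none}) :=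
  ((clusterAlgebra V).comap (laurentInclusion V)).map σ.specialise

/-- The vertex `v` is polyamorous for the partial labelling `σ`: it is not labelled, and all
elements of the specialised cluster algebra are polynomial in the variable `x_v`. -/
def IsPolyamorous (σ : PartialLabelling V) (v : V) : Prop :=
  ∃ h : σ v = none, ∀ f ∈ specialisedClusterAlgebra σ, MvLaurent.IsPolynomialIn ⟨v, h⟩ f

end ClusterAlgebra

/-! Fix `a ∈ A` and write the exchange relation at `a` as `x_a x_a' = P`, where `P` is a monomial
times `1 + ∏ x_v ^ b v a` and does not involve `x_a`. A cluster variable is a Laurent polynomial in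
the initial cluster. It is also one in the cluster mutated at `a`, because mutating at `a` again
returns to the initial seed. In the latter expression substitute `x_a' = P / x_a`: positive powers
of `x_a'` acquire a factor `P`, all other terms are polynomial in `x_a`. After clearing powers of
`P` this gives the form `g + P h` with `g` polynomial in `x_a` (`exists_eq_add_exchangePoly_mul`). A
labelling with `∏ σ(v) ^ b v a = -1` kills `P`, and only `g` survives.

Such a labelling gives `-1` to one chosen neighbour of each `a ∈ A` and `1` to all other vertices
outside `A`. Disjointness of the neighbourhoods leaves exactly one `-1` next to each `a`, and
simplicity of the arrows gives it exponent `±1`.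

The Laurent phenomenon is proved by induction on the mutation word, by intersecting the Laurent
rings of nearby clusters. This needs coprime exchange polynomials, which fails for `Q` itself when
columns of its matrix are dependent. Therefore everything is done with principal coefficients, where
the mutable columns are independent, and the frozen variables are set to `1` at the end. -/

set_option linter.unusedSectionVars false

/-! ### Laurent monomials, evaluation and truncation by exponents. -/

namespace MvLaurent

variable {V : Type*}

/-- The Laurent monomial with exponent vector `m`. -/
noncomputable def mono (m : V → ℤ) : MvLaurent V := (monomialUnit m : MvLaurent V)

theorem mono_def (m : V → ℤ) : mono m = AddMonoidAlgebra.single m 1 := rfl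

theorem isUnit_mono (m : V → ℤ) : IsUnit (mono m) := (monomialUnit m).isUnit

theorem mono_zero : mono (0 : V → ℤ) = 1 := rfl

theorem mono_add (m n : V → ℤ) : mono (m + n) = mono m * mono n := by
  simp [mono_def, AddMonoidAlgebra.single_mul_single]

theorem mono_neg_mul (m : V → ℤ) : mono (-m) * mono m = 1 := by
  rw [← mono_add, neg_add_cancel, mono_zero]

theorem var_eq_mono [DecidableEq V] (v : V) : (var v : MvLaurent V) = mono (Pi.single v 1) := rfl

theorem one_add_mono_ne_zero (m : V → ℤ) : (1 + mono m : MvLaurent V) ≠ 0 := by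
  classical
  intro h
  have h0 := congrArg (fun f : MvLaurent V => f.coeff 0) h
  rw [← mono_zero, mono_def, mono_def] at h0
  by_cases hm : m = 0
  · simp [hm] at h0
  · simp [hm] at h0

theorem mono_induction {p : MvLaurent V → Prop} (f : MvLaurent V) (hm : ∀ m, p (mono m))
    (hadd : ∀ f g, p f → p g → p (f + g)) (hsmul : ∀ (c : ℤ) f, p f → p (c • f)) : p f :=
  AddMonoidAlgebra.induction_on f (fun m => hm m) hadd hsmul

theorem eval_mono [Fintype V] {R : Type*} [CommRing R] (u : V → Rˣ) (m : V → ℤ) :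
    eval u (mono m) = ((∏ v, u v ^ m v : Rˣ) : R) := by
  rw [mono_def, eval, AddMonoidAlgebra.lift_single, one_smul]
  rfl

theorem eval_var [Fintype V] [DecidableEq V] {R : Type*} [CommRing R] (u : V → Rˣ) (v : V) :
    eval u (var v : MvLaurent V) = u v := by
  rw [var_eq_mono, eval_mono]
  congr 1
  rw [Finset.prod_eq_single v]
  · simp
  · intro w _ hw
    simp [hw]
  · simp

theorem mono_eq_prod [Fintype V] [DecidableEq V] (m : V → ℤ) :
    mono m = ((∏ v, var v ^ m v : (MvLaurent V)ˣ) : MvLaurent V) := by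
  let F : Multiplicative (V → ℤ) →* (MvLaurent V)ˣ :=
    { toFun := fun m => monomialUnit m.toAdd
      map_one' := Units.ext mono_zero
      map_mul' := fun m n => Units.ext (mono_add m.toAdd n.toAdd) }
  have h : monomialUnit m = ∏ v, var v ^ m v := by
    have h1 : m = ∑ v, m v • (Pi.single v 1 : V → ℤ) := by
      ext w
      simp [Finset.sum_apply, Pi.single_apply]
    have h2 : F (Multiplicative.ofAdd (∑ v, m v • (Pi.single v 1 : V → ℤ))) =
        ∏ v, var v ^ m v := by
      rw [ofAdd_sum, map_prod]
      refine Finset.prod_congr rfl fun v _ => ?_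
      rw [ofAdd_zsmul, map_zpow]
      rfl
    rw [← h2, ← h1]
    rfl
  rw [← h]
  rfl

theorem map_mono [Fintype V] [DecidableEq V] {K : Type*} [Field K]
    (φ : MvLaurent V →+* K) (m : V → ℤ) :
    φ (mono m) = ∏ v, φ (var v : MvLaurent V) ^ m v := by
  have h := congrArg Units.val
    (map_prod (Units.map (φ : MvLaurent V →* K)) (fun v => var v ^ m v) Finset.univ)
  rw [Units.coe_map, ← mono_eq_prod, Units.coe_prod] at h
  refine h.trans (Finset.prod_congr rfl fun v _ => ?_)
  rw [map_zpow, Units.val_zpow_eq_zpow_val]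
  rfl

/-- The part of a Laurent polynomial consisting of the terms whose exponent vector satisfies
`p`. -/
noncomputable def restrict (p : (V → ℤ) → Prop) : MvLaurent V →+ MvLaurent V := by
  classical
  exact
  { toFun := fun f => AddMonoidAlgebra.ofCoeff (f.coeff.filter p)
    map_zero' := congrArg _ (Finsupp.filter_zero p)
    map_add' := fun f g => congrArg _ Finsupp.filter_add }

theorem coeff_restrict (p : (V → ℤ) → Prop) [DecidablePred p] (f : MvLaurent V) (m : V → ℤ) :
    (restrict p f).coeff m = if p m then f.coeff m else 0 := by
  rw [restrict]
  change (@Finsupp.filter _ _ _ p (fun a => Classical.propDecidable (p a)) f.coeff) m = _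
  rw [Finsupp.filter_apply]
  split_ifs <;> rfl

theorem coeff_mono_mul (m n : V → ℤ) (f : MvLaurent V) :
    (mono m * f).coeff n = f.coeff (n - m) := by
  rw [mono_def, AddMonoidAlgebra.coeff_single_mul_apply]
  simp [sub_eq_neg_add]

theorem restrict_mono_mul {p : (V → ℤ) → Prop} {m : V → ℤ} (hp : ∀ n, p (n - m) ↔ p n)
    (f : MvLaurent V) : restrict p (mono m * f) = mono m * restrict p f := by
  classical
  ext n
  rw [coeff_restrict, coeff_mono_mul, coeff_mono_mul, coeff_restrict]
  simp [hp n]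

/-! ### Coprimality without unique factorisation. -/

/-- Multiplication by `w` is injective modulo `z`. -/
def Cop {R : Type*} [CommRing R] (z w : R) : Prop := ∀ g, z ∣ w * g → z ∣ g

section Cop

variable {R : Type*} [CommRing R]

theorem Cop.of_isUnit_left {z : R} (w : R) (hz : IsUnit z) : Cop z w := fun _ _ => hz.dvd

theorem Cop.of_isUnit_right (z : R) {w : R} (hw : IsUnit w) : Cop z w := fun g hg => by
  obtain ⟨u, rfl⟩ := hw
  simpa using hg.mul_left (↑u⁻¹ : R)

theorem Cop.mul_right {z w w' : R} (h : Cop z w) (h' : Cop z w') : Cop z (w * w') :=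
  fun g hg => h' g (h _ (by rwa [← mul_assoc]))

theorem Cop.mul_left [IsDomain R] {z z' w : R} (h : Cop z w) (h' : Cop z' w) :
    Cop (z * z') w := by
  intro g hg
  obtain ⟨g', rfl⟩ := h g ((Dvd.intro _ rfl).trans hg)
  by_cases hz : z = 0
  · simp [hz]
  refine mul_dvd_mul_left z (h' g' ?_)
  rw [mul_left_comm] at hg
  exact (mul_dvd_mul_iff_left hz).1 hg

theorem Cop.prod_right {ι : Type*} (s : Finset ι) {z : R} {w : ι → R} (h : ∀ i, Cop z (w i)) :
    Cop z (∏ i ∈ s, w i) :=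
  Finset.prod_induction w (Cop z) (fun _ _ => Cop.mul_right) (Cop.of_isUnit_right z isUnit_one)
    fun i _ => h i

theorem Cop.prod_left [IsDomain R] {ι : Type*} (s : Finset ι) {z : ι → R} {w : R}
    (h : ∀ i, Cop (z i) w) : Cop (∏ i ∈ s, z i) w :=
  Finset.prod_induction z (Cop · w) (fun _ _ => Cop.mul_left) (Cop.of_isUnit_left w isUnit_one)
    fun i _ => h i

theorem Cop.pow_pow [IsDomain R] {z w : R} (h : Cop z w) (m n : ℕ) : Cop (z ^ m) (w ^ n) := by
  have h1 : Cop z (w ^ n) := by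
    simpa using Cop.prod_right (Finset.range n) (w := fun _ => w) (fun _ => h)
  simpa using Cop.prod_left (Finset.range m) (z := fun _ => z) (fun _ => h1)

theorem Cop.of_eq_one_add (z t : R) : Cop z (1 + z * t) := fun g hg => by
  have : (1 + z * t) * g = g + z * (t * g) := by ring
  rw [this] at hg
  exact (dvd_add_left (Dvd.intro _ rfl)).1 hg

end Cop

/-- Grade by `l`, so that `1 + mono c` is homogeneous of degree `0`. If it divides `(1 + mono b) *
f`, then modulo it `f` is congruent up to sign to its translate by any multiple of `b`. A far
translate has degrees disjoint from those of `f`, and truncating the congruence to the degrees of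
`f` leaves `f` itself as a multiple. -/
theorem cop_one_add_mono {c b : V → ℤ} (l : (V → ℤ) →+ ℤ) (hc : l c = 0) (hb : l b ≠ 0) :
    Cop (1 + mono c : MvLaurent V) (1 + mono b) := by
  classical
  intro f hf
  have step : ∀ n : ℕ, (1 + mono c : MvLaurent V) ∣ f - (-1) ^ n * (mono (n • b) * f) := by
    intro n
    induction n with
    | zero => simp [mono_zero]
    | succ n ih =>
      have h := ih.add (hf.mul_left ((-1) ^ n * mono (n • b)))
      convert h using 1
      rw [succ_nsmul, mono_add]
      ring
  -- All degrees of `f` are below `N / 2` in absolute value, whereas translation by `N • b` changes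
  -- degrees by at least `N`; the translate therefore misses the strip `p`.
  let N : ℕ := 2 * ∑ m ∈ f.coeff.support, (l m).natAbs + 1
  have hlt : ∀ m, f.coeff m ≠ 0 → 2 * (l m).natAbs < N := by
    intro m hm
    have := Finset.single_le_sum (f := fun m => (l m).natAbs) (fun _ _ => Nat.zero_le _)
      (Finsupp.mem_support_iff.2 hm)
    omega
  let p : (V → ℤ) → Prop := fun m => 2 * (l m).natAbs < N
  obtain ⟨h, hh⟩ := step N
  have h1 : restrict p f = f := by
    ext m
    rw [coeff_restrict]
    split_ifs with hm
    · rfl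
    · by_contra hne
      exact hm (hlt m (Ne.symm hne))
  have h2 : restrict p ((-1) ^ N * (mono (N • b) * f)) = 0 := by
    have : restrict p (mono (N • b) * f) = 0 := by
      ext m
      rw [coeff_restrict]
      split_ifs with hm
      · rw [coeff_mono_mul]
        by_contra hne
        have h3 := hlt _ hne
        rw [map_sub, map_nsmul, nsmul_eq_mul] at h3
        have h4 : N ≤ (N * l b).natAbs := by
          rw [Int.natAbs_mul, Int.natAbs_natCast]
          exact Nat.le_mul_of_pos_right _ (Int.natAbs_pos.2 hb)
        have h5 : 2 * (l m).natAbs < N := hm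
        omega
      · rfl
    rcases neg_one_pow_eq_or (MvLaurent V) N with h | h
    · rw [h, one_mul, this]
    · rw [h, neg_one_mul, map_neg, this, neg_zero]
  have h3 : restrict p ((1 + mono c) * h) = (1 + mono c) * restrict p h := by
    rw [add_mul, map_add, one_mul, restrict_mono_mul, add_mul, one_mul]
    intro n
    simp only [p, map_sub, hc, sub_zero]
  have h4 := congrArg (restrict p) hh
  rw [map_sub, h1, h2, sub_zero, h3] at h4
  exact ⟨_, h4⟩

end MvLaurent

/-! ### Seeds with exchange matrices and their mutation. -/

/-- A seed whose quiver is given by an integer exchange matrix `b`. -/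
@[ext]
structure ExchangeSeed (I K : Type*) where
  b : I → I → ℤ
  x : I → K

namespace ExchangeSeed

open MvLaurent

variable {I K : Type*} [Fintype I] [DecidableEq I] [Field K]

/-- Mutation of a seed in direction `k`. -/
noncomputable def mutate (k : I) (s : ExchangeSeed I K) : ExchangeSeed I K where
  b := fun i j =>
    if i = k ∨ j = k then -s.b i j
    else s.b i j + (max (s.b i k) 0 * max (s.b k j) 0 - max (-s.b i k) 0 * max (-s.b k j) 0)
  x := Function.update s.x k
    ((∏ i, s.x i ^ (s.b i k).toNat + ∏ i, s.x i ^ (-s.b i k).toNat) / s.x k)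

/-- The seed with all arrows reversed. -/
def op (s : ExchangeSeed I K) : ExchangeSeed I K where
  b := fun i j => -s.b i j
  x := s.x

theorem op_mutate (k : I) (s : ExchangeSeed I K) : (s.mutate k).op = s.op.mutate k := by
  ext i j
  · simp only [op, mutate]
    split_ifs
    · rfl
    · simp only [neg_neg]
      ring
  · simp only [op, mutate, neg_neg]
    rw [add_comm]

theorem mutate_b_left (k j : I) (s : ExchangeSeed I K) : (s.mutate k).b k j = -s.b k j := by
  simp [mutate]

theorem mutate_b_right (k j : I) (s : ExchangeSeed I K) : (s.mutate k).b j k = -s.b j k := by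
  simp [mutate]

theorem mutate_x_of_ne {k i : I} (h : i ≠ k) (s : ExchangeSeed I K) :
    (s.mutate k).x i = s.x i := by
  simp [mutate, h]

/-- The monomial in the cluster whose exponents are the `j`-th column of the exchange matrix. -/
noncomputable def yhat (s : ExchangeSeed I K) (j : I) : K := ∏ i, s.x i ^ s.b i j

/-- The exchange matrix is skew-symmetric. -/
def IsSkew (s : ExchangeSeed I K) : Prop := ∀ i j, s.b i j = -s.b j i

theorem IsSkew.self {s : ExchangeSeed I K} (h : s.IsSkew) (i : I) : s.b i i = 0 := by
  have := h i i
  omega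

theorem IsSkew.mutate {s : ExchangeSeed I K} (h : s.IsSkew) (k : I) : (s.mutate k).IsSkew := by
  intro i j
  simp only [ExchangeSeed.mutate]
  rw [h i j, h i k, h k j]
  by_cases hi : i = k <;> by_cases hj : j = k <;> simp only [hi, hj, or_true, or_false, if_true,
    if_false, neg_neg]
  ring

theorem mutate_x_self {s : ExchangeSeed I K} (hx : ∀ i, s.x i ≠ 0) (k : I) :
    (s.mutate k).x k = (∏ i, s.x i ^ max (-s.b i k) 0) * (1 + s.yhat k) / s.x k := by
  simp only [mutate, Function.update_self, yhat]
  congr 1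
  rw [mul_add, mul_one, ← Finset.prod_mul_distrib, add_comm]
  congr 1
  · refine Finset.prod_congr rfl fun i _ => ?_
    rw [← zpow_natCast, Int.ofNat_toNat]
  · refine Finset.prod_congr rfl fun i _ => ?_
    rw [← zpow_natCast, Int.ofNat_toNat, ← zpow_add₀ (hx i)]
    congr 1
    omega

theorem mutate_mutate {s : ExchangeSeed I K} (hs : s.IsSkew) (hx : ∀ i, s.x i ≠ 0) (k : I)
    (hk : (s.mutate k).x k ≠ 0) : (s.mutate k).mutate k = s := by
  ext i j
  · simp only [mutate]
    by_cases h : i = k ∨ j = k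
    · simp [h]
    · simp only [h, or_true, true_or, if_true, if_false, neg_neg]
      ring
  · by_cases h : i = k
    · subst h
      have hP : ∀ (e : I → ℕ), e i = 0 →
          ∏ l, (s.mutate i).x l ^ e l = ∏ l, s.x l ^ e l := by
        intro e he
        refine Finset.prod_congr rfl fun l _ => ?_
        by_cases hl : l = i
        · subst hl
          simp [he]
        · rw [mutate_x_of_ne hl]
      have h1 : ((s.mutate i).mutate i).x i = (∏ l, (s.mutate i).x l ^ (-s.b l i).toNat +
          ∏ l, (s.mutate i).x l ^ (s.b l i).toNat) / (s.mutate i).x i := by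
        conv_lhs => rw [mutate]
        simp only [Function.update_self, mutate_b_right, neg_neg]
      rw [h1, hP _ (by simp [hs.self]), hP _ (by simp [hs.self]), div_eq_iff hk]
      simp only [mutate, Function.update_self]
      rw [mul_div_cancel₀ _ (hx i), add_comm]
    · rw [mutate_x_of_ne h, mutate_x_of_ne h]

theorem mutate_b_of_eq_zero (s : ExchangeSeed I K) {j k : I} (hjk : j ≠ k)
    (hb : s.b j k = 0) (i : I) : (s.mutate j).b i k = s.b i k := by
  by_cases hi : i = j
  · subst hi
    simp [mutate, hb]
  · simp [mutate, hb, hi, hjk.symm]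

theorem mutate_comm {s : ExchangeSeed I K} (hs : s.IsSkew) {j k : I} (hjk : j ≠ k)
    (hb : s.b j k = 0) : (s.mutate j).mutate k = (s.mutate k).mutate j := by
  have hb' : s.b k j = 0 := by rw [hs, hb, neg_zero]
  ext i l
  · have hkj := hjk.symm
    simp only [mutate]
    by_cases h1 : i = j <;> by_cases h2 : i = k <;> by_cases h3 : l = j <;> by_cases h4 : l = k <;>
      simp_all
    all_goals ring
  · have hx : ∀ {j k : I}, j ≠ k → s.b j k = 0 → ∀ e : I → ℕ, e j = 0 →
        ∏ i, (s.mutate j).x i ^ e i = ∏ i, s.x i ^ e i := by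
      intro j k hjk hb e he
      refine Finset.prod_congr rfl fun i _ => ?_
      by_cases hi : i = j
      · subst hi
        simp [he]
      · rw [mutate_x_of_ne hi]
    have key : ∀ {j k : I}, j ≠ k → s.b j k = 0 →
        ((s.mutate j).mutate k).x k = (s.mutate k).x k := by
      intro j k hjk hb
      have h1 : ((s.mutate j).mutate k).x k = (∏ l, (s.mutate j).x l ^ (s.b l k).toNat +
          ∏ l, (s.mutate j).x l ^ (-s.b l k).toNat) / (s.mutate j).x k := by
        conv_lhs => rw [mutate]
        simp only [Function.update_self, mutate_b_of_eq_zero s hjk hb]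
      rw [h1, hx hjk hb _ (by simp [hb]), hx hjk hb _ (by simp [hb]), mutate_x_of_ne hjk.symm]
      simp only [mutate, Function.update_self]
    by_cases h1 : i = k
    · subst h1
      rw [key hjk hb, mutate_x_of_ne hjk.symm]
    · by_cases h2 : i = j
      · subst h2
        rw [mutate_x_of_ne h1, key hjk.symm hb']
      · rw [mutate_x_of_ne h1, mutate_x_of_ne h2, mutate_x_of_ne h2, mutate_x_of_ne h1]

theorem yhat_mutate_self {s : ExchangeSeed I K} (hs : s.IsSkew) (k : I) :
    (s.mutate k).yhat k = (s.yhat k)⁻¹ := by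
  rw [yhat, yhat, ← Finset.prod_inv_distrib]
  refine Finset.prod_congr rfl fun i _ => ?_
  by_cases h : i = k
  · subst h
    simp [mutate_b_right, hs.self]
  · rw [mutate_x_of_ne h, mutate_b_right, zpow_neg]

/-- The new `x_k` is `Q (1 + ŷ_k) / x_k` with a monomial `Q`. The change in the entries of column
`j` contributes `Q ^ b k j`, which cancels the power of `Q` coming from the new `x_k`. -/
theorem yhat_mutate {s : ExchangeSeed I K} (hs : s.IsSkew) (hx : ∀ i, s.x i ≠ 0) {j k : I}
    (hjk : j ≠ k) (hb : s.b k j ≤ 0) :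
    (s.mutate k).yhat j = s.yhat j * (1 + s.yhat k) ^ (-s.b k j).toNat := by
  have hQ : (∏ i, s.x i ^ max (-s.b i k) 0) ≠ 0 :=
    Finset.prod_ne_zero_iff.2 fun i _ => zpow_ne_zero _ (hx i)
  set Q := ∏ i, s.x i ^ max (-s.b i k) 0 with hQdef
  have h : ∀ i, (s.mutate k).x i ^ (s.mutate k).b i j = s.x i ^ s.b i j *
      (s.x i ^ max (-s.b i k) 0) ^ s.b k j *
      (if i = k then (Q * (1 + s.yhat k)) ^ (-s.b k j) else 1) := by
    intro i
    by_cases h : i = k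
    · subst h
      rw [mutate_x_self hx, mutate_b_left, hs.self, if_pos rfl, div_zpow, ← hQdef]
      simp only [neg_zero, max_self, zpow_zero, one_zpow, mul_one]
      rw [div_eq_mul_inv, ← zpow_neg, neg_neg, mul_comm]
    · rw [mutate_x_of_ne h, if_neg h, mul_one, ← zpow_mul, ← zpow_add₀ (hx i)]
      congr 1
      simp only [mutate, h, hjk, or_self, if_false]
      rw [max_eq_right hb, max_eq_left (by omega : 0 ≤ -s.b k j)]
      ring
  rw [yhat, Finset.prod_congr rfl fun i _ => h i, Finset.prod_mul_distrib,
    Finset.prod_mul_distrib, Finset.prod_zpow, ← hQdef, Finset.prod_ite_eq' Finset.univ k,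
    if_pos (Finset.mem_univ k), mul_zpow, ← yhat, mul_assoc, ← mul_assoc (Q ^ _),
    ← zpow_add₀ hQ, add_neg_cancel, zpow_zero, one_mul, ← zpow_natCast,
    Int.toNat_of_nonneg (by omega)]

/-! ### Independence of the columns under mutation. -/

/-- The columns of the exchange matrix with index in `M` are linearly independent. -/
def FullRankOn (M : Set I) (s : ExchangeSeed I K) : Prop :=
  ∀ c : I → ℤ, (∀ i ∉ M, c i = 0) → (∀ i, ∑ q, s.b i q * c q = 0) → c = 0

theorem FullRankOn.mutate {M : Set I} {s : ExchangeSeed I K} (h : s.FullRankOn M)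
    (hs : s.IsSkew) {k : I} (hk : k ∈ M) : (s.mutate k).FullRankOn M := by
  intro c hcM hc
  have hk0 : ∑ q, s.b k q * c q = 0 := by
    have := hc k
    simp only [mutate_b_left, neg_mul, Finset.sum_neg_distrib, neg_eq_zero] at this
    exact this
  -- Matrix mutation is a row operation combined with a column operation. `d` is the image of `c`
  -- under the column operation; the row operation adds multiples of row `k`, on which `c` vanishes
  -- by `hk0`.
  let d : I → ℤ := fun q => if q = k then ∑ q, max (-s.b k q) 0 * c q - c k else c q
  have hd : d = 0 := by
    refine h d (fun i hi => ?_) fun i => ?_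
    · have : i ≠ k := fun h => hi (h ▸ hk)
      simp only [d, this, if_false]
      exact hcM i hi
    · have hsplit : ∑ q, s.b i q * d q =
          ∑ q, s.b i q * c q + s.b i k * (∑ q, max (-s.b k q) 0 * c q - 2 * c k) := by
        have : ∀ q, s.b i q * d q = s.b i q * c q +
            if q = k then s.b i k * (∑ q, max (-s.b k q) 0 * c q - 2 * c k) else 0 := by
          intro q
          by_cases hq : q = k
          · subst hq
            simp only [d, if_true]
            ring
          · simp [d, hq]
        rw [Finset.sum_congr rfl fun q _ => this q, Finset.sum_add_distrib,
          Finset.sum_ite_eq' Finset.univ k, if_pos (Finset.mem_univ k)]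
      rw [hsplit]
      by_cases hi : i = k
      · subst hi
        rw [hk0, hs.self, zero_mul, zero_add]
      · have h2 : ∀ q, (s.mutate k).b i q * c q = s.b i q * c q +
            max (s.b i k) 0 * (s.b k q * c q) + s.b i k * (max (-s.b k q) 0 * c q) -
            if q = k then 2 * (s.b i k * c k) else 0 := by
          intro q
          by_cases hq : q = k
          · subst hq
            rw [mutate_b_right, hs.self]
            simp
            ring
          · have e : ∀ a e : ℤ, max a 0 * max e 0 - max (-a) 0 * max (-e) 0 =
                max a 0 * e + a * max (-e) 0 := by
              intro a e
              rcases le_total a 0 with ha | ha <;> rcases le_total e 0 with he | he <;>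
                simp [ha, he]
            simp only [ExchangeSeed.mutate, hi, hq, or_self, if_false, e]
            ring
        have h3 := hc i
        rw [Finset.sum_congr rfl fun q _ => h2 q, Finset.sum_sub_distrib, Finset.sum_add_distrib,
          Finset.sum_add_distrib, ← Finset.mul_sum, ← Finset.mul_sum, hk0,
          Finset.sum_ite_eq' Finset.univ k, if_pos (Finset.mem_univ k)] at h3
        linarith
  have hq : ∀ q, q ≠ k → c q = 0 := by
    intro q hq
    have := congrFun hd q
    simpa [d, hq] using this
  ext q
  by_cases hqk : q = k
  · subst hqk
    have := congrFun hd q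
    simp only [d, if_true] at this
    rw [Finset.sum_eq_zero] at this
    · simpa using this
    · intro l _
      by_cases hl : l = q
      · subst hl
        simp [hs.self]
      · simp [hq l hl]
  · exact hq q hqk

/-- Otherwise the functionals `b p j • ev_q - b q j • ev_p`, which kill column `j`, also kill column
`k`. Then all 2×2 minors of the two columns vanish, contradicting independence. -/
theorem FullRankOn.exists_functional {M : Set I} {s : ExchangeSeed I K} (h : s.FullRankOn M)
    {j k : I} (hj : j ∈ M) (hk : k ∈ M) (hjk : j ≠ k) :
    ∃ l : (I → ℤ) →+ ℤ, l (fun i => s.b i j) = 0 ∧ l (fun i => s.b i k) ≠ 0 := by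
  by_contra! hcon
  have hminor : ∀ p q, s.b p j * s.b q k = s.b q j * s.b p k := by
    intro p q
    have := hcon (s.b p j • Pi.evalAddMonoidHom (fun _ => ℤ) q -
      s.b q j • Pi.evalAddMonoidHom (fun _ => ℤ) p) (by simp [mul_comm])
    simpa [sub_eq_zero] using this
  have hsum : ∀ (i : I) (a c : ℤ), ∑ q, s.b i q * (if q = j then a else if q = k then c else 0) =
      s.b i j * a + s.b i k * c := by
    intro i a c
    rw [Fintype.sum_eq_add j k hjk]
    · simp [hjk.symm]
    · rintro q ⟨h1, h2⟩
      simp [h1, h2]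
  have hzero : ∀ p, s.b p j = 0 := by
    intro p
    have h0 := h (fun q => if q = j then s.b p k else if q = k then -s.b p j else 0) ?_ ?_
    · have := congrFun h0 k
      simpa [hjk.symm] using this
    · intro i hi
      have h1 : i ≠ j := fun h => hi (h ▸ hj)
      have h2 : i ≠ k := fun h => hi (h ▸ hk)
      simp [h1, h2]
    · intro i
      rw [hsum]
      linarith [hminor p i]
  have h0 := h (fun q => if q = j then 1 else if q = k then 0 else 0) ?_ ?_
  · have := congrFun h0 j
    simp at this
  · intro i hi
    have h1 : i ≠ j := fun h => hi (h ▸ hj)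
    simp [h1]
  · intro i
    rw [hsum, hzero]
    simp

/-! ### Algebraic independence of clusters under mutation. -/

/-- The columns of the exchange matrix with index in `M` are independent, and the cluster is
algebraically independent. -/
structure IsGood (M : Set I) (s : ExchangeSeed I K) : Prop where
  skew : s.IsSkew
  fullRank : s.FullRankOn M
  free : ∃ φ : MvLaurent I →+* K, Function.Injective φ ∧ ∀ i, φ (var i : MvLaurent I) = s.x i

theorem IsGood.x_ne_zero {M : Set I} {s : ExchangeSeed I K} (h : s.IsGood M) (i : I) :
    s.x i ≠ 0 := by
  obtain ⟨φ, hφ, hx⟩ := h.free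
  rw [← hx, Ne, map_eq_zero_iff φ hφ]
  exact (isUnit_mono _).ne_zero

/-- The `k`-th column of the exchange matrix as a Laurent monomial. -/
noncomputable def ymono (s : ExchangeSeed I K) (k : I) : MvLaurent I := mono fun i => s.b i k

theorem map_ymono {s : ExchangeSeed I K} {φ : MvLaurent I →+* K}
    (hx : ∀ i, φ (var i : MvLaurent I) = s.x i) (k : I) : φ (s.ymono k) = s.yhat k := by
  rw [ymono, map_mono, yhat]
  simp only [hx]

/-- The exchange polynomial as an element of the Laurent polynomial ring. -/
noncomputable def exchangePoly (s : ExchangeSeed I K) (k : I) : MvLaurent I :=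
  mono (fun i => max (-s.b i k) 0) * (1 + s.ymono k)

theorem exchangePoly_ne_zero (s : ExchangeSeed I K) (k : I) : s.exchangePoly k ≠ 0 :=
  mul_ne_zero (isUnit_mono _).ne_zero (one_add_mono_ne_zero _)

theorem mutate_x_self_eq {M : Set I} {s : ExchangeSeed I K} (hs : s.IsGood M)
    {φ : MvLaurent I →+* K} (hx : ∀ i, φ (var i : MvLaurent I) = s.x i) (k : I) :
    (s.mutate k).x k = φ (s.exchangePoly k) / s.x k := by
  rw [mutate_x_self hs.x_ne_zero, exchangePoly, map_mul, map_add, map_one, map_ymono hx,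
    map_mono]
  simp only [hx]

theorem map_mono_eq {φ φ' : MvLaurent I →+* K} {k : I}
    (h : ∀ i, i ≠ k → φ' (var i : MvLaurent I) = φ (var i : MvLaurent I)) {m : I → ℤ}
    (hm : m k = 0) : φ' (mono m) = φ (mono m) := by
  rw [map_mono, map_mono]
  refine Finset.prod_congr rfl fun i _ => ?_
  by_cases hi : i = k
  · subst hi
    simp [hm]
  · rw [h i hi]

theorem map_exchangePoly_eq {s : ExchangeSeed I K} (hs : s.IsSkew) {φ φ' : MvLaurent I →+* K}
    {k : I} (h : ∀ i, i ≠ k → φ' (var i : MvLaurent I) = φ (var i : MvLaurent I)) :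
    φ' (s.exchangePoly k) = φ (s.exchangePoly k) := by
  rw [exchangePoly, map_mul, map_mul, map_add, map_add, map_one, map_one, ymono,
    map_mono_eq h (by simp [hs.self]), map_mono_eq h (by simp [hs.self])]

theorem map_mono_mutate {φ φ' : MvLaurent I →+* K} {k : I} {P : K}
    (h : ∀ i, i ≠ k → φ' (var i : MvLaurent I) = φ (var i : MvLaurent I))
    (hk : φ' (var k : MvLaurent I) = P / φ (var k : MvLaurent I)) (m : I → ℤ) :
    φ' (mono m) = P ^ m k * φ (mono (m - Pi.single k (2 * m k))) := by
  rw [map_mono, map_mono]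
  have : ∀ i, φ' (var i : MvLaurent I) ^ m i = (if i = k then P ^ m k else 1) *
      φ (var i : MvLaurent I) ^ ((m - Pi.single k (2 * m k) : I → ℤ) i) := by
    intro i
    by_cases hi : i = k
    · subst hi
      rw [hk, if_pos rfl, Pi.sub_apply, Pi.single_eq_same, div_zpow, div_eq_mul_inv, ← zpow_neg]
      congr 2
      ring
    · simp [hi, h i hi]
  rw [Finset.prod_congr rfl fun i _ => this i, Finset.prod_mul_distrib,
    Finset.prod_ite_eq' Finset.univ k, if_pos (Finset.mem_univ k)]

theorem injective_of_mutate {s : ExchangeSeed I K} (hs : s.IsSkew) {φ φ' : MvLaurent I →+* K}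
    {k : I} (hφ : Function.Injective φ)
    (h : ∀ i, i ≠ k → φ' (var i : MvLaurent I) = φ (var i : MvLaurent I))
    (hk : φ' (var k : MvLaurent I) = φ (s.exchangePoly k) / φ (var k : MvLaurent I)) :
    Function.Injective φ' := by
  have hP0 : φ (s.exchangePoly k) ≠ 0 := by
    rw [Ne, map_eq_zero_iff φ hφ]
    exact s.exchangePoly_ne_zero k
  have hv0 : ∀ i : I, φ (var i : MvLaurent I) ≠ 0 := by
    intro i
    rw [Ne, map_eq_zero_iff φ hφ]
    exact (isUnit_mono _).ne_zero
  have hPP := map_exchangePoly_eq hs h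
  have hv0' : ∀ i : I, φ' (var i : MvLaurent I) ≠ 0 := by
    intro i
    by_cases hi : i = k
    · subst hi
      rw [hk]
      exact div_ne_zero hP0 (hv0 i)
    · rw [h i hi]
      exact hv0 i
  have hk' : φ (var k : MvLaurent I) = φ (s.exchangePoly k) / φ' (var k : MvLaurent I) := by
    rw [hk, div_div_cancel₀ hP0]
  set P := s.exchangePoly k
  -- Up to powers of `P`, the substitution `x_k ↦ P / x_k` is an involution: `g` goes to `f` and `f`
  -- goes back to `g`. Hence `φ' g = 0` forces `f = 0` and then `g = 0`.
  have key : ∀ g, ∃ (N : ℕ) (f : MvLaurent I),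
      φ P ^ N * φ' g = φ f ∧ φ' f = φ P ^ N * φ g := by
    intro g
    induction g using mono_induction with
    | hm m =>
      have hm1 := map_mono_mutate h hk m
      rcases le_total 0 (m k) with hm | hm
      · refine ⟨0, P ^ (m k).toNat * mono (m - Pi.single k (2 * m k)), ?_, ?_⟩
        · rw [hm1, map_mul, map_pow, pow_zero, one_mul, ← zpow_natCast, Int.toNat_of_nonneg hm]
        · rw [map_mul, map_pow, hPP, map_mono_mutate h hk, ← zpow_natCast,
            Int.toNat_of_nonneg hm, ← mul_assoc, ← zpow_add₀ hP0, pow_zero, one_mul]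
          simp only [Pi.sub_apply, Pi.single_eq_same]
          rw [show m k + (m k - 2 * m k) = 0 by ring, zpow_zero, one_mul]
          congr 2
          ext i
          by_cases hi : i = k
          · subst hi
            simp
            ring
          · simp [hi]
      · refine ⟨(-m k).toNat, mono (m - Pi.single k (2 * m k)), ?_, ?_⟩
        · rw [hm1, ← zpow_natCast, Int.toNat_of_nonneg (by omega), ← mul_assoc,
            ← zpow_add₀ hP0, neg_add_cancel, zpow_zero, one_mul]
        · rw [map_mono_mutate h hk, ← zpow_natCast, Int.toNat_of_nonneg (by omega)]
          simp only [Pi.sub_apply, Pi.single_eq_same]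
          rw [show m k - 2 * m k = -m k by ring]
          congr 3
          ext i
          by_cases hi : i = k
          · subst hi
            simp
          · simp [hi]
    | hadd f g hf hg =>
      obtain ⟨N, f', h1, h2⟩ := hf
      obtain ⟨N', g', h3, h4⟩ := hg
      refine ⟨N + N', P ^ N' * f' + P ^ N * g', ?_, ?_⟩
      · rw [map_add, map_add, map_mul, map_mul, map_pow, map_pow, ← h1, ← h3]
        ring
      · rw [map_add, map_add, map_mul, map_mul, map_pow, map_pow, hPP, h2, h4]
        ring
    | hsmul c f hf =>
      obtain ⟨N, f', h1, h2⟩ := hf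
      refine ⟨N, c • f', ?_, ?_⟩
      · rw [map_zsmul, map_zsmul, mul_smul_comm, h1]
      · rw [map_zsmul, map_zsmul, mul_smul_comm, h2]
  rw [injective_iff_map_eq_zero]
  intro g hg
  obtain ⟨N, f, h1, h2⟩ := key g
  rw [hg, mul_zero, eq_comm, map_eq_zero_iff φ hφ] at h1
  rw [h1, map_zero, eq_comm, mul_eq_zero, map_eq_zero_iff φ hφ] at h2
  exact h2.resolve_left (pow_ne_zero _ hP0)

theorem IsGood.mutate {M : Set I} {s : ExchangeSeed I K} (hs : s.IsGood M) {k : I} (hk : k ∈ M) :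
    (s.mutate k).IsGood M := by
  obtain ⟨φ, hφ, hx⟩ := hs.free
  have hxk := mutate_x_self_eq hs hx k
  have hne : ∀ i, (s.mutate k).x i ≠ 0 := by
    intro i
    by_cases hi : i = k
    · subst hi
      rw [hxk]
      refine div_ne_zero ?_ (hs.x_ne_zero i)
      rw [Ne, map_eq_zero_iff φ hφ]
      exact s.exchangePoly_ne_zero i
    · rw [mutate_x_of_ne hi]
      exact hs.x_ne_zero i
  have hev : ∀ i, MvLaurent.eval (fun i => Units.mk0 _ (hne i)) (var i : MvLaurent I) =
      (s.mutate k).x i := fun i => by rw [eval_var, Units.val_mk0]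
  refine ⟨hs.skew.mutate k, hs.fullRank.mutate hs.skew hk, _,
    injective_of_mutate (φ' := (MvLaurent.eval _).toRingHom) (k := k) hs.skew hφ ?_ ?_, hev⟩
  · intro i hi
    exact (hev i).trans (by rw [hx, mutate_x_of_ne hi])
  · exact (hev k).trans (by rw [hx, hxk])

theorem IsGood.op {M : Set I} {s : ExchangeSeed I K} (hs : s.IsGood M) : s.op.IsGood M where
  skew := fun i j => congrArg Neg.neg (hs.skew i j)
  fullRank := fun c hc h => hs.fullRank c hc fun i => by
    have := h i
    simpa [ExchangeSeed.op] using this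
  free := hs.free

theorem IsGood.mutate_mutate {M : Set I} {s : ExchangeSeed I K} (hs : s.IsGood M) {k : I}
    (hk : k ∈ M) : (s.mutate k).mutate k = s :=
  ExchangeSeed.mutate_mutate hs.skew hs.x_ne_zero k ((hs.mutate hk).x_ne_zero k)

end ExchangeSeed

/-! ### The Laurent phenomenon. -/

namespace ExchangeSeed

open MvLaurent

variable {I K : Type*} [Fintype I] [DecidableEq I] [Field K]

/-- The ring of Laurent polynomials with integer coefficients in the elements `x i`. -/
def laurentSubring (x : I → K) : Subalgebra ℤ K :=
  Algebra.adjoin ℤ (Set.range x ∪ Set.range fun i => (x i)⁻¹)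

theorem mem_laurentSubring (x : I → K) (i : I) : x i ∈ laurentSubring x :=
  Algebra.subset_adjoin (Or.inl ⟨i, rfl⟩)

theorem inv_mem_laurentSubring (x : I → K) (i : I) : (x i)⁻¹ ∈ laurentSubring x :=
  Algebra.subset_adjoin (Or.inr ⟨i, rfl⟩)

theorem map_mono_neg (φ : MvLaurent I →+* K) (m : I → ℤ) :
    φ (mono (-m)) = (φ (mono m))⁻¹ := by
  refine eq_inv_of_mul_eq_one_left ?_
  rw [← map_mul, mono_neg_mul, map_one]

theorem mem_laurentSubring_iff {x : I → K} {φ : MvLaurent I →+* K}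
    (hx : ∀ i, φ (var i : MvLaurent I) = x i) (f : K) :
    f ∈ laurentSubring x ↔ ∃ g, φ g = f := by
  constructor
  · intro hf
    have : laurentSubring x ≤ φ.toIntAlgHom.range := by
      refine Algebra.adjoin_le ?_
      rintro _ (⟨i, rfl⟩ | ⟨i, rfl⟩)
      · exact ⟨_, hx i⟩
      · refine ⟨mono (-Pi.single i 1), ?_⟩
        change φ _ = _
        rw [map_mono_neg, ← var_eq_mono, hx]
    exact this hf
  · rintro ⟨g, rfl⟩
    induction g using mono_induction with
    | hm m =>
      rw [map_mono]
      refine Subalgebra.prod_mem _ fun i _ => ?_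
      rw [hx]
      rcases Int.eq_nat_or_neg (m i) with ⟨n, h | h⟩
      · rw [h, zpow_natCast]
        exact Subalgebra.pow_mem _ (mem_laurentSubring x i) n
      · rw [h, zpow_neg, zpow_natCast, ← inv_pow]
        exact Subalgebra.pow_mem _ (inv_mem_laurentSubring x i) n
    | hadd f g hf hg =>
      rw [map_add]
      exact Subalgebra.add_mem _ hf hg
    | hsmul c f hf =>
      rw [map_zsmul]
      exact Subalgebra.smul_mem _ hf c

theorem exists_mul_pow_mem {x : I → K} (S : Subalgebra ℤ K) (hS : ∀ i, x i ∈ S) {f : K}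
    (hf : f ∈ laurentSubring x) : ∃ N : ℕ, f * (∏ i, x i) ^ N ∈ S := by
  have hprod : ∏ i, x i ∈ S := Subalgebra.prod_mem _ fun i _ => hS i
  induction hf using Algebra.adjoin_induction with
  | mem f hf =>
    rcases hf with ⟨i, rfl⟩ | ⟨i, rfl⟩
    · exact ⟨0, by simp [hS]⟩
    · refine ⟨1, ?_⟩
      dsimp only
      by_cases h : x i = 0
      · rw [h, inv_zero, zero_mul]
        exact Subalgebra.zero_mem _
      · rw [pow_one, ← Finset.mul_prod_erase Finset.univ x (Finset.mem_univ i),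
          inv_mul_cancel_left₀ h]
        exact Subalgebra.prod_mem _ fun i _ => hS i
  | algebraMap c => exact ⟨0, by simp⟩
  | add f g _ _ hf hg =>
    obtain ⟨N, hN⟩ := hf
    obtain ⟨N', hN'⟩ := hg
    refine ⟨N + N', ?_⟩
    have : (f + g) * (∏ i, x i) ^ (N + N') = f * (∏ i, x i) ^ N * (∏ i, x i) ^ N' +
        g * (∏ i, x i) ^ N' * (∏ i, x i) ^ N := by ring
    rw [this]
    exact Subalgebra.add_mem _ (Subalgebra.mul_mem _ hN (Subalgebra.pow_mem _ hprod _))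
      (Subalgebra.mul_mem _ hN' (Subalgebra.pow_mem _ hprod _))
  | mul f g _ _ hf hg =>
    obtain ⟨N, hN⟩ := hf
    obtain ⟨N', hN'⟩ := hg
    refine ⟨N + N', ?_⟩
    have : f * g * (∏ i, x i) ^ (N + N') = f * (∏ i, x i) ^ N * (g * (∏ i, x i) ^ N') := by ring
    rw [this]
    exact Subalgebra.mul_mem _ hN hN'

/-- Write `f` over a power of `∏ U i` and over a power of `∏ W i`. Comparing the two fractions,
coprimality makes the first denominator divide its numerator. -/
theorem mem_laurentSubring_of_cop {s : ExchangeSeed I K} {φ : MvLaurent I →+* K}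
    (hφ : Function.Injective φ) (hx : ∀ i, φ (var i : MvLaurent I) = s.x i)
    {U W : I → MvLaurent I} (hU : ∀ i, U i ≠ 0) (hcop : ∀ i l, Cop (U i) (W l)) {f : K}
    (hfU : f ∈ laurentSubring fun i => φ (U i)) (hfW : f ∈ laurentSubring fun i => φ (W i)) :
    f ∈ laurentSubring s.x := by
  rw [mem_laurentSubring_iff hx]
  obtain ⟨N, g, hg⟩ := exists_mul_pow_mem φ.toIntAlgHom.range (fun i => ⟨U i, rfl⟩) hfU
  obtain ⟨N', h, hh⟩ := exists_mul_pow_mem φ.toIntAlgHom.range (fun i => ⟨W i, rfl⟩) hfW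
  have hg' : φ g = f * φ (∏ i, U i) ^ N := by rw [map_prod]; exact hg
  have hh' : φ h = f * φ (∏ i, W i) ^ N' := by rw [map_prod]; exact hh
  have hc : Cop (∏ i, U i) (∏ i, W i) :=
    Cop.prod_left _ fun i => Cop.prod_right _ fun l => hcop i l
  obtain ⟨q, hq⟩ := hc.pow_pow N N' g ⟨h, hφ (by
    rw [map_mul, map_mul, map_pow, map_pow, hg', hh']
    ring)⟩
  refine ⟨q, ?_⟩
  have hne : φ (∏ i, U i) ≠ 0 := by
    rw [Ne, map_eq_zero_iff φ hφ]
    exact Finset.prod_ne_zero_iff.2 fun i _ => hU i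
  rw [hq, map_mul, map_pow, mul_comm] at hg'
  exact mul_right_cancel₀ (pow_ne_zero N hne) hg'

theorem cop_one_add_ymono {M : Set I} {s : ExchangeSeed I K} (hs : s.FullRankOn M) {j k : I}
    (hj : j ∈ M) (hk : k ∈ M) (hjk : j ≠ k) : Cop (1 + s.ymono j) (1 + s.ymono k) := by
  obtain ⟨l, h1, h2⟩ := hs.exists_functional hj hk hjk
  exact cop_one_add_mono l h1 h2

/-- The `i`-th cluster variable after mutation at `k`, as a Laurent polynomial. -/
noncomputable def mutatedVar (s : ExchangeSeed I K) (k i : I) : MvLaurent I :=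
  if i = k then mono (-Pi.single k 1) * s.exchangePoly k else var i

theorem map_mutatedVar {M : Set I} {s : ExchangeSeed I K} (hs : s.IsGood M)
    {φ : MvLaurent I →+* K} (hx : ∀ i, φ (var i : MvLaurent I) = s.x i) (k i : I) :
    φ (s.mutatedVar k i) = (s.mutate k).x i := by
  rw [mutatedVar]
  split_ifs with h
  · subst h
    rw [mutate_x_self_eq hs hx, map_mul, map_mono_neg, ← var_eq_mono, hx, div_eq_inv_mul]
  · rw [mutate_x_of_ne h, hx]

theorem mutatedVar_self (s : ExchangeSeed I K) (k : I) :
    s.mutatedVar k k =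
      mono (-Pi.single k 1) * (mono (fun i => max (-s.b i k) 0) * (1 + s.ymono k)) := by
  rw [mutatedVar, if_pos rfl, exchangePoly]

theorem isUnit_mutatedVar (s : ExchangeSeed I K) {k i : I} (h : i ≠ k) :
    IsUnit (s.mutatedVar k i) := by
  rw [mutatedVar, if_neg h]
  exact isUnit_mono _

theorem mutatedVar_ne_zero (s : ExchangeSeed I K) (k i : I) : s.mutatedVar k i ≠ 0 := by
  by_cases h : i = k
  · subst h
    rw [mutatedVar, if_pos rfl]
    exact mul_ne_zero (isUnit_mono _).ne_zero (s.exchangePoly_ne_zero i)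
  · exact (s.isUnit_mutatedVar h).ne_zero

theorem cop_mutatedVar {s : ExchangeSeed I K} {j : I} {w : MvLaurent I}
    (h : Cop (1 + s.ymono j) w) (i : I) : Cop (s.mutatedVar j i) w := by
  by_cases hi : i = j
  · subst hi
    rw [mutatedVar_self]
    exact (Cop.of_isUnit_left _ (isUnit_mono _)).mul_left
      ((Cop.of_isUnit_left _ (isUnit_mono _)).mul_left h)
  · exact Cop.of_isUnit_left _ (s.isUnit_mutatedVar hi)

/-- In each mutated cluster only the new variable can fail to be a unit of the Laurent ring of `s`;
up to a monomial these are `1 + ŷ_j` and `1 + ŷ_k`, which are coprime. -/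
theorem mem_laurentSubring_of_b_eq_zero {M : Set I} {s : ExchangeSeed I K} (hs : s.IsGood M)
    {j k : I} (hj : j ∈ M) (hk : k ∈ M) (hjk : j ≠ k) {f : K}
    (h1 : f ∈ laurentSubring (s.mutate j).x) (h2 : f ∈ laurentSubring (s.mutate k).x) :
    f ∈ laurentSubring s.x := by
  obtain ⟨φ, hφ, hx⟩ := hs.free
  refine mem_laurentSubring_of_cop hφ hx (U := s.mutatedVar j) (W := s.mutatedVar k)
    (s.mutatedVar_ne_zero j) (fun i l => cop_mutatedVar ?_ i) ?_ ?_
  · by_cases hl : l = k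
    · subst hl
      rw [mutatedVar_self]
      exact (Cop.of_isUnit_right _ (isUnit_mono _)).mul_right
        ((Cop.of_isUnit_right _ (isUnit_mono _)).mul_right
          (cop_one_add_ymono hs.fullRank hj hk hjk))
    · exact Cop.of_isUnit_right _ (s.isUnit_mutatedVar hl)
  · simpa only [map_mutatedVar hs hx] using h1
  · simpa only [map_mutatedVar hs hx] using h2

/-- Up to a monomial, `v` is the variable created by the last of the mutations at `j`, `k`, `j`,
with `a` arrows between `j` and `k`. For `a = 1` it is `1 + w`; for `a ≥ 2` the power is `1` modulo
`(1 + y) ^ 2`, so `v` is `1` modulo `1 + y`. -/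
theorem exists_mul_eq_add_pow {R : Type*} [CommRing R] (y w : R) (h : Cop (1 + y) (1 + w))
    {a : ℕ} (ha : a ≠ 0) : ∃ v, (1 + y) * v = y + (1 + w * (1 + y) ^ a) ^ a ∧ Cop (1 + y) v := by
  by_cases ha1 : a = 1
  · subst ha1
    exact ⟨1 + w, by ring, h⟩
  · obtain ⟨c, rfl⟩ : ∃ c, a = c + 2 := ⟨a - 2, by omega⟩
    obtain ⟨r, hr⟩ := sub_dvd_pow_sub_pow (1 + w * (1 + y) ^ (c + 2)) 1 (c + 2)
    refine ⟨1 + (1 + y) * (w * (1 + y) ^ c * r), ?_, Cop.of_eq_one_add _ _⟩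
    rw [one_pow, sub_eq_iff_eq_add] at hr
    rw [hr]
    ring

theorem prod_zpow_eq_map_mono {s t : ExchangeSeed I K} {φ : MvLaurent I →+* K}
    (hx : ∀ i, φ (var i : MvLaurent I) = s.x i) {e : I → ℤ}
    (h : ∀ i, e i ≠ 0 → t.x i = s.x i) : ∏ i, t.x i ^ e i = φ (mono e) := by
  rw [map_mono]
  refine Finset.prod_congr rfl fun i _ => ?_
  by_cases hi : e i = 0
  · simp [hi]
  · rw [h i hi, hx]

/-- Modulo `1 + ŷ_j`, the denominator of the first ring, the variable at `k` after the mutations at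
`j` and `k` is a unit, and the variable at `j` after the third mutation is the `v` of
`exists_mul_eq_add_pow` up to a monomial. So the denominators of the two rings are coprime. -/
theorem mem_laurentSubring_of_b_neg {M : Set I} {s : ExchangeSeed I K} (hs : s.IsGood M)
    {j k : I} (hj : j ∈ M) (hk : k ∈ M) (hb : s.b j k < 0) {f : K}
    (h1 : f ∈ laurentSubring (s.mutate j).x)
    (h2 : f ∈ laurentSubring (((s.mutate j).mutate k).mutate j).x) :
    f ∈ laurentSubring s.x := by
  have hjk : j ≠ k := by
    rintro rfl
    simp [hs.skew.self] at hb
  obtain ⟨φ, hφ, hx⟩ := hs.free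
  have hs1 := hs.mutate hj
  have hs2 := hs1.mutate hk
  set t1 := s.mutate j with ht1
  set t2 := t1.mutate k with ht2
  set a := (-s.b j k).toNat with ha
  have ha0 : a ≠ 0 := by omega
  obtain ⟨v, hv, hvcop⟩ := exists_mul_eq_add_pow (s.ymono j) (s.ymono k)
    (cop_one_add_ymono hs.fullRank hj hk hjk) ha0
  set y := s.ymono j with hy
  set w := s.ymono k with hw
  have hy1k : t1.yhat k = φ (w * (1 + y) ^ a) := by
    rw [ht1, yhat_mutate hs.skew hs.x_ne_zero hjk.symm hb.le, ← map_ymono hx, ← map_ymono hx]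
    simp [hy, hw, ha]
  have hy1j : t1.yhat j = (φ y)⁻¹ := by
    rw [ht1, yhat_mutate_self hs.skew, ← map_ymono hx]
  have hb1 : t1.b k j = s.b j k := by
    rw [ht1, mutate_b_right, hs.skew k j, neg_neg]
  have hb1' : t1.b j k = -s.b j k := by rw [ht1, mutate_b_left]
  have hy2j : t2.yhat j = (φ y)⁻¹ * φ (1 + w * (1 + y) ^ a) ^ a := by
    rw [ht2, yhat_mutate hs1.skew hs1.x_ne_zero hjk (by rw [hb1]; exact hb.le), hy1j, hy1k, hb1,
      map_add, map_one]
  have hx1 : ∀ i, i ≠ j → t1.x i = s.x i := fun i hi => mutate_x_of_ne hi s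
  have hx2 : ∀ i, i ≠ k → t2.x i = t1.x i := fun i hi => mutate_x_of_ne hi t1
  have hu : t2.x k = φ (mono (fun i => max (-t1.b i k) 0) * (1 + w * (1 + y) ^ a) *
      mono (-Pi.single k 1)) := by
    rw [ht2, mutate_x_self hs1.x_ne_zero, hy1k, hx1 k hjk.symm,
      prod_zpow_eq_map_mono (s := s) (t := t1) hx, map_mul φ (_ * _), map_mul φ _ (1 + _),
      map_add, map_one, map_mono_neg, ← var_eq_mono, hx, div_eq_mul_inv]
    -- Here the sign of `b j k` matters: it makes the exponent at `j` zero, so the monomial does not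
    -- involve the mutated variable at `j`.
    intro i hi
    refine hx1 i ?_
    rintro rfl
    rw [hb1'] at hi
    omega
  have hvx : (t2.mutate j).x j = φ (mono (fun i => max (-t2.b i j) 0) *
      (mono (Pi.single j 1) * (mono (-fun i => max (-s.b i j) 0) *
        (mono (-fun i => s.b i j) * v)))) := by
    have hz : t2.x j = φ (s.mutatedVar j j) := by
      rw [hx2 j hjk, ht1, map_mutatedVar hs hx]
    have hone : φ (mono (-fun i => s.b i j) * ((1 + y) * v)) = 1 + t2.yhat j := by
      rw [hv, hy2j, map_mul, map_add, map_pow, map_mono_neg, mul_add]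
      congr 1
      refine inv_mul_cancel₀ ?_
      rw [Ne, map_eq_zero_iff φ hφ]
      exact (isUnit_mono _).ne_zero
    rw [mutate_x_self hs2.x_ne_zero, div_eq_iff (hs2.x_ne_zero j), ← hone, hz,
      prod_zpow_eq_map_mono (s := s) (t := t2) hx, ← map_mul, ← map_mul, mutatedVar_self]
    · congr 1
      have e1 := mono_neg_mul (Pi.single j 1 : I → ℤ)
      have e2 := mono_neg_mul (fun i => max (-s.b i j) 0)
      linear_combination (-mono (fun i => max (-t2.b i j) 0) * (mono (-fun i => s.b i j) *
        ((1 + y) * v)) * (mono (-fun i => max (-s.b i j) 0) * mono fun i => max (-s.b i j) 0)) *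
        e1 - mono (fun i => max (-t2.b i j) 0) * (mono (-fun i => s.b i j) * ((1 + y) * v)) * e2
    · intro i hi
      have hij : i ≠ j := by
        rintro rfl
        rw [hs2.skew.self] at hi
        simp at hi
      have hik : i ≠ k := by
        rintro rfl
        rw [ht2, mutate_b_left, hb1] at hi
        omega
      rw [hx2 i hik, hx1 i hij]
  let W : I → MvLaurent I := fun i =>
    if i = j then mono (fun i => max (-t2.b i j) 0) *
      (mono (Pi.single j 1) * (mono (-fun i => max (-s.b i j) 0) *
        (mono (-fun i => s.b i j) * v)))
    else if i = k then mono (fun i => max (-t1.b i k) 0) * (1 + w * (1 + y) ^ a) *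
      mono (-Pi.single k 1)
    else var i
  have hW : ∀ i, φ (W i) = (t2.mutate j).x i := by
    intro i
    simp only [W]
    split_ifs with h h'
    · subst h
      rw [hvx]
    · subst h'
      rw [mutate_x_of_ne h, hu]
    · rw [mutate_x_of_ne h, hx2 i h', hx1 i h, hx]
  refine mem_laurentSubring_of_cop hφ hx (U := s.mutatedVar j) (W := W)
    (s.mutatedVar_ne_zero j) (fun i l => cop_mutatedVar ?_ i) ?_ ?_
  · have hm : ∀ m : I → ℤ, Cop (1 + s.ymono j) (mono m) := fun m =>
      Cop.of_isUnit_right _ (isUnit_mono _)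
    simp only [W]
    split_ifs
    · exact (hm _).mul_right ((hm _).mul_right ((hm _).mul_right ((hm _).mul_right hvcop)))
    · refine ((hm _).mul_right ?_).mul_right (hm _)
      have : 1 + w * (1 + y) ^ a = 1 + (1 + y) * (w * (1 + y) ^ (a - 1)) := by
        conv_lhs => rw [← Nat.sub_add_cancel (Nat.pos_of_ne_zero ha0)]
        ring
      rw [this]
      exact Cop.of_eq_one_add _ _
    · exact hm _
  · simpa only [map_mutatedVar hs hx] using h1
  · simpa only [hW] using h2

theorem mem_laurentSubring_of_b_ne_zero {M : Set I} {s : ExchangeSeed I K} (hs : s.IsGood M)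
    {j k : I} (hj : j ∈ M) (hk : k ∈ M) (hb : s.b j k ≠ 0) {f : K}
    (h1 : f ∈ laurentSubring (s.mutate j).x)
    (h2 : f ∈ laurentSubring (((s.mutate j).mutate k).mutate j).x) :
    f ∈ laurentSubring s.x := by
  rcases lt_or_gt_of_ne hb with hb | hb
  · exact mem_laurentSubring_of_b_neg hs hj hk hb h1 h2
  -- Reversing all arrows commutes with mutation and keeps the clusters, so the positive sign
  -- reduces to the negative one.
  · refine mem_laurentSubring_of_b_neg (s := s.op) hs.op hj hk ?_ ?_ ?_
    · change -s.b j k < 0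
      omega
    · rwa [← op_mutate]
    · rwa [← op_mutate, ← op_mutate, ← op_mutate]

/-- Successive mutation at the elements of a list. -/
noncomputable def mutateList (w : List I) (s : ExchangeSeed I K) : ExchangeSeed I K :=
  w.foldl (fun s k => s.mutate k) s

theorem mutateList_cons (k : I) (w : List I) (s : ExchangeSeed I K) :
    s.mutateList (k :: w) = (s.mutate k).mutateList w := rfl

theorem mutateList_concat (k : I) (w : List I) (s : ExchangeSeed I K) :
    s.mutateList (w ++ [k]) = (s.mutateList w).mutate k := by
  simp [mutateList]

theorem IsGood.mutateList {M : Set I} {w : List I} (hw : ∀ k ∈ w, k ∈ M)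
    {s : ExchangeSeed I K} (hs : s.IsGood M) : (s.mutateList w).IsGood M := by
  induction w generalizing s with
  | nil => exact hs
  | cons k w ih =>
    rw [mutateList_cons]
    exact ih (fun l hl => hw l (List.mem_cons_of_mem k hl)) (hs.mutate (hw k List.mem_cons_self))

theorem laurent_phenomenon {M : Set I} (w : List I) (hw : ∀ k ∈ w, k ∈ M)
    {s : ExchangeSeed I K} (hs : s.IsGood M) (i : I) :
    (s.mutateList w).x i ∈ laurentSubring s.x := by
  match w, hw with
  | [], _ => exact mem_laurentSubring s.x i
  | [k], _ =>
    obtain ⟨φ, -, hx⟩ := hs.free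
    rw [mem_laurentSubring_iff hx]
    exact ⟨_, map_mutatedVar hs hx k i⟩
  | j :: k :: w, hw =>
    have hj : j ∈ M := hw j (by simp)
    have hk : k ∈ M := hw k (by simp)
    have hw' : ∀ l ∈ w, l ∈ M := fun l hl => hw l (by simp [hl])
    have hkw : ∀ l ∈ k :: w, l ∈ M := fun l hl => hw l (List.mem_cons_of_mem j hl)
    have hjw : ∀ l ∈ j :: w, l ∈ M := fun l hl => (List.mem_cons.1 hl).elim (· ▸ hj) (hw' l)
    have hsj := hs.mutate hj
    have h1 : (s.mutateList (j :: k :: w)).x i ∈ laurentSubring (s.mutate j).x :=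
      laurent_phenomenon (k :: w) hkw hsj i
    by_cases hjk : j = k
    · subst hjk
      rw [mutateList_cons, mutateList_cons, hs.mutate_mutate hj]
      exact laurent_phenomenon w hw' hs i
    by_cases hb : s.b j k = 0
    · refine mem_laurentSubring_of_b_eq_zero hs hj hk hjk h1 ?_
      rw [mutateList_cons, mutateList_cons, mutate_comm hs.skew hjk hb]
      exact laurent_phenomenon (j :: w) hjw (hs.mutate hk) i
    · refine mem_laurentSubring_of_b_ne_zero hs hj hk hb h1 ?_
      -- Starting from the seed mutated at `j`, `k`, `j`, the word `j :: w` first undoes the last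
      -- mutation and so ends at the same seed, while being one letter shorter.
      have h2 := laurent_phenomenon (j :: w) hjw ((hsj.mutate hk).mutate hj) i
      rwa [mutateList_cons, (hsj.mutate hk).mutate_mutate hj] at h2
  termination_by w.length

end ExchangeSeed

/-! ### Polynomiality in one variable. -/

namespace MvLaurent

variable {V : Type*}

/-- The subalgebra of the Laurent polynomials that are polynomial in `x_v`. -/
noncomputable def polynomialSubalgebra (v : V) : Subalgebra ℤ (MvLaurent V) where
  carrier := {f | IsPolynomialIn v f}
  mul_mem' := by
    classical
    intro f g hf hg m hm
    have h := AddMonoidAlgebra.support_coeff_mul_subset f g (Finsupp.mem_support_iff.2 hm)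
    obtain ⟨m₁, h₁, m₂, h₂, rfl⟩ := Finset.mem_add.1 h
    exact add_nonneg (hf m₁ (Finsupp.mem_support_iff.1 h₁)) (hg m₂ (Finsupp.mem_support_iff.1 h₂))
  add_mem' := by
    intro f g hf hg m hm
    by_cases h : f.coeff m = 0
    · refine hg m fun h' => hm ?_
      rw [AddMonoidAlgebra.coeff_add, Finsupp.add_apply, h, h', add_zero]
    · exact hf m h
  algebraMap_mem' := by
    classical
    intro c m hm
    by_contra h
    refine hm ?_
    rw [Algebra.algebraMap_eq_smul_one, ← mono_zero, AddMonoidAlgebra.coeff_smul_apply, mono_def,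
      AddMonoidAlgebra.coeff_single, Finsupp.single_apply, if_neg, smul_zero]
    rintro rfl
    exact h le_rfl

theorem mono_mem_polynomialSubalgebra {v : V} {m : V → ℤ} (h : 0 ≤ m v) :
    mono m ∈ polynomialSubalgebra v := by
  classical
  intro n hn
  rw [mono_def, AddMonoidAlgebra.coeff_single, Finsupp.single_apply] at hn
  split_ifs at hn with hmn
  · exact hmn ▸ h
  · exact absurd rfl hn

theorem map_mem_of_isPolynomialIn {W : Type*} (F : MvLaurent V →+* MvLaurent W)
    (S : Subalgebra ℤ (MvLaurent W)) {v : V} (hF : ∀ m : V → ℤ, 0 ≤ m v → F (mono m) ∈ S) {f : MvLaurent V}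
    (hf : IsPolynomialIn v f) : F f ∈ S := by
  have h : f = ∑ m ∈ f.coeff.support, f.coeff m • mono m := by
    conv_lhs => rw [← AddMonoidAlgebra.sum_coeff_single f]
    refine Finset.sum_congr rfl fun m _ => ?_
    rw [mono_def, AddMonoidAlgebra.smul_single, smul_eq_mul, mul_one]
  rw [h, map_sum]
  refine Subalgebra.sum_mem _ fun m hm => ?_
  rw [map_zsmul]
  exact Subalgebra.smul_mem _ (hF m (hf m (Finsupp.mem_support_iff.1 hm))) _

theorem restrict_add_restrict_not (p : (V → ℤ) → Prop) (f : MvLaurent V) :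
    restrict (fun m => ¬p m) f + restrict p f = f := by
  classical
  ext m
  rw [AddMonoidAlgebra.coeff_add, Finsupp.add_apply, coeff_restrict, coeff_restrict]
  by_cases h : p m <;> simp [h]

end MvLaurent

namespace ExchangeSeed

open MvLaurent

variable {I K : Type*} [Fintype I] [DecidableEq I] [Field K]

theorem restrict_exchangePoly_pow_mul {s : ExchangeSeed I K} (hs : s.IsSkew) (k : I) (N : ℕ)
    (f : MvLaurent I) : restrict (fun m => m k < 0) (s.exchangePoly k ^ N * f) =
      s.exchangePoly k ^ N * restrict (fun m => m k < 0) f := by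
  induction N generalizing f with
  | zero => simp
  | succ N ih =>
    rw [pow_succ, mul_assoc, ih, mul_assoc]
    congr 1
    rw [exchangePoly, mul_assoc, mul_assoc, restrict_mono_mul, add_mul, add_mul, one_mul, one_mul,
      map_add, ymono, restrict_mono_mul]
    · intro n
      simp [hs.self]
    · intro n
      simp [hs.self]

/-- An element that is a Laurent polynomial both in a cluster and in its mutation at `k` is,
modulo the exchange polynomial, polynomial in `x_k`. -/
theorem exists_eq_add_exchangePoly_mul {M : Set I} {s : ExchangeSeed I K} (hs : s.IsGood M)
    {k : I} (hk : k ∈ M) {φ : MvLaurent I →+* K} (hφ : Function.Injective φ)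
    (hx : ∀ i, φ (var i : MvLaurent I) = s.x i) {f : MvLaurent I}
    (hf : φ f ∈ laurentSubring (s.mutate k).x) :
    ∃ g h, IsPolynomialIn k g ∧ f = g + s.exchangePoly k * h := by
  obtain ⟨φ', -, hx'⟩ := (hs.mutate hk).free
  have h1 : ∀ i, i ≠ k → φ' (var i : MvLaurent I) = φ (var i : MvLaurent I) := fun i hi => by
    rw [hx', hx, mutate_x_of_ne hi]
  have hk' : φ' (var k : MvLaurent I) = φ (s.exchangePoly k) / φ (var k : MvLaurent I) := by
    rw [hx', hx, mutate_x_self_eq hs hx]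
  have hP0 : φ (s.exchangePoly k) ≠ 0 := by
    rw [Ne, map_eq_zero_iff φ hφ]
    exact s.exchangePoly_ne_zero k
  have hPmem : s.exchangePoly k ∈ polynomialSubalgebra k := by
    refine Subalgebra.mul_mem _ (mono_mem_polynomialSubalgebra (by simp [hs.skew.self]))
      (Subalgebra.add_mem _ (Subalgebra.one_mem _) (mono_mem_polynomialSubalgebra ?_))
    simp [hs.skew.self]
  set P := s.exchangePoly k with hP
  -- The exponent `N + 1` is the point: monomials with a positive power of the mutated variable
  -- carry one more factor `P` than the denominator, and the remaining ones are polynomial in `x_k`.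
  have key : ∀ e, ∃ (N : ℕ) (g h : MvLaurent I), g ∈ polynomialSubalgebra k ∧
      φ P ^ N * φ' e = φ (g + P ^ (N + 1) * h) := by
    intro e
    induction e using mono_induction with
    | hm m =>
      have hm1 := map_mono_mutate h1 hk' m
      rcases lt_or_ge 0 (m k) with hm | hm
      · refine ⟨0, 0, P ^ (m k - 1).toNat * mono (m - Pi.single k (2 * m k)),
          Subalgebra.zero_mem _, ?_⟩
        obtain ⟨n, hn⟩ : ∃ n : ℕ, m k = n + 1 := ⟨(m k - 1).toNat, by omega⟩
        have hn' : (m k - 1).toNat = n := by omega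
        rw [hm1, hn', zero_add, zero_add, pow_one, pow_zero, one_mul, ← mul_assoc, ← pow_succ',
          map_mul, map_pow, ← zpow_natCast, Nat.cast_succ, ← hn]
      · refine ⟨(-m k).toNat, mono (m - Pi.single k (2 * m k)), 0,
          mono_mem_polynomialSubalgebra ?_, ?_⟩
        · simp only [Pi.sub_apply, Pi.single_eq_same]
          omega
        · rw [hm1, ← zpow_natCast, Int.toNat_of_nonneg (by omega), ← mul_assoc,
            ← zpow_add₀ hP0, neg_add_cancel, zpow_zero, one_mul, mul_zero, add_zero]
    | hadd e e' he he' =>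
      obtain ⟨N, g, h, hg, h2⟩ := he
      obtain ⟨N', g', h', hg', h2'⟩ := he'
      refine ⟨N + N', P ^ N' * g + P ^ N * g', h + h',
        Subalgebra.add_mem _ (Subalgebra.mul_mem _ (Subalgebra.pow_mem _ hPmem _) hg)
          (Subalgebra.mul_mem _ (Subalgebra.pow_mem _ hPmem _) hg'), ?_⟩
      have e1 : φ P ^ (N + N') * φ' (e + e') =
          φ P ^ N' * (φ P ^ N * φ' e) + φ P ^ N * (φ P ^ N' * φ' e') := by
        rw [map_add]
        ring
      rw [e1, h2, h2', ← map_pow, ← map_pow, ← map_mul, ← map_mul, ← map_add]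
      congr 1
      ring
    | hsmul c e he =>
      obtain ⟨N, g, h, hg, h2⟩ := he
      refine ⟨N, c • g, c • h, Subalgebra.smul_mem _ hg c, ?_⟩
      rw [map_zsmul, mul_smul_comm, h2, ← map_zsmul, smul_add, mul_smul_comm]
  obtain ⟨e, he⟩ := (mem_laurentSubring_iff hx' _).1 hf
  obtain ⟨N, g, h, hg, h2⟩ := key e
  rw [he, ← map_pow, ← map_mul] at h2
  -- Taking the part with negative `x_k`-exponent removes `g` and commutes with `P`, which is free
  -- of `x_k`. After cancelling `P ^ N`, the negative part of `f` is a multiple of `P`.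
  have h3 := congrArg (restrict fun m => m k < 0) (hφ h2)
  have hg0 : restrict (fun m => m k < 0) g = 0 := by
    classical
    ext m
    rw [coeff_restrict]
    split_ifs with hm
    · by_contra hne
      exact absurd (hg m hne) (not_le.2 hm)
    · rfl
  rw [map_add, hg0, zero_add, hP, restrict_exchangePoly_pow_mul hs.skew,
    restrict_exchangePoly_pow_mul hs.skew, pow_succ, mul_assoc] at h3
  have h4 := mul_left_cancel₀ (pow_ne_zero N (s.exchangePoly_ne_zero k)) h3
  refine ⟨restrict (fun m => ¬m k < 0) f, restrict (fun m => m k < 0) h, ?_, ?_⟩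
  · classical
    intro m hm
    rw [coeff_restrict] at hm
    by_contra hneg
    simp [not_le.1 hneg] at hm
  · rw [← h4, restrict_add_restrict_not]

end ExchangeSeed

open MvLaurent

/-! ### Principal coefficients and specialisation of the frozen variables. -/

section PrincipalCoefficients

variable (V : Type*) [Fintype V] [DecidableEq V] [Quiver V]

/-- The initial seed of a quiver with principal coefficients: the variables indexed by the second
copy of the vertex set are frozen. -/
noncomputable def principalSeed : ExchangeSeed (V ⊕ V) (RationalFunctionField (V ⊕ V)) where
  b
    | .inl i, .inl j => (Nat.card (i ⟶ j) : ℤ) - Nat.card (j ⟶ i)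
    | .inl i, .inr j => if i = j then -1 else 0
    | .inr i, .inl j => if i = j then 1 else 0
    | .inr _, .inr _ => 0
  x i := algebraMap (MvLaurent (V ⊕ V)) (RationalFunctionField (V ⊕ V))
    (MvLaurent.var i : MvLaurent (V ⊕ V))

/-- The inclusion of the Laurent polynomials into the rational functions, with principal
coefficients. -/
noncomputable def principalInclusion :
    MvLaurent (V ⊕ V) →+* RationalFunctionField (V ⊕ V) :=
  algebraMap (MvLaurent (V ⊕ V)) (RationalFunctionField (V ⊕ V))

theorem laurentInclusion_injective : Function.Injective (laurentInclusion V) :=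
  IsFractionRing.injective (MvLaurent V) (RationalFunctionField V)

theorem principalInclusion_injective : Function.Injective (principalInclusion V) :=
  IsFractionRing.injective (MvLaurent (V ⊕ V)) (RationalFunctionField (V ⊕ V))

theorem principalInclusion_var (i : V ⊕ V) :
    principalInclusion V (MvLaurent.var i : MvLaurent (V ⊕ V)) = (principalSeed V).x i := rfl

/-- The frozen rows of the mutable columns form an identity matrix, so these columns are independent
for every quiver. -/
theorem principalSeed_isGood : (principalSeed V).IsGood (Set.range Sum.inl) where
  skew := by
    rintro (i | i) (j | j)
    · simp [principalSeed]
    · simp only [principalSeed, eq_comm (a := j)]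
      split_ifs <;> rfl
    · simp only [principalSeed, eq_comm (a := j)]
      split_ifs <;> rfl
    · simp [principalSeed]
  fullRank := by
    intro c hc h
    ext (i | i)
    · have := h (.inr i)
      rw [Fintype.sum_sum_type] at this
      simpa [principalSeed] using this
    · exact hc _ (by simp)
  free := ⟨_, principalInclusion_injective V, principalInclusion_var V⟩

variable {V}

/-- The specialisation of the frozen variables to `1`. -/
noncomputable def specialiseFrozen (V : Type*) [Fintype V] [DecidableEq V] :
    MvLaurent (V ⊕ V) →+* MvLaurent V :=
  (MvLaurent.eval (Sum.elim MvLaurent.var 1)).toRingHom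

omit [Quiver V] in
theorem specialiseFrozen_var (i : V ⊕ V) :
    specialiseFrozen V (MvLaurent.var i : MvLaurent (V ⊕ V)) =
      (Sum.elim MvLaurent.var 1 i : (MvLaurent V)ˣ) :=
  eval_var _ _

omit [Quiver V] in
theorem specialiseFrozen_mono (m : V ⊕ V → ℤ) :
    specialiseFrozen V (mono m) = mono fun v : V => m (.inl v) := by
  change MvLaurent.eval _ _ = _
  rw [eval_mono, Fintype.prod_sum_type, mono_eq_prod]
  simp

/-- `E` is a seed with principal coefficients whose cluster consists of the Laurent polynomials
`X`, and `S` is the seed obtained from it by setting the frozen variables to `1`. -/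
structure IsPrincipalLift (S : Seed V (RationalFunctionField V))
    (E : ExchangeSeed (V ⊕ V) (RationalFunctionField (V ⊕ V)))
    (X : V ⊕ V → MvLaurent (V ⊕ V)) : Prop where
  x : ∀ i, principalInclusion V (X i) = E.x i
  arrows : ∀ i j, S.arrows i j = (E.b (.inl i) (.inl j)).toNat
  cluster : ∀ v, S.cluster v =
    laurentInclusion V (specialiseFrozen V (X (.inl v)))
  frozen : ∀ v, specialiseFrozen V (X (.inr v)) = 1
  pos : ∀ v, 0 < (MvLaurent.eval fun _ => (1 : ℤˣ)).toRingHom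
    (specialiseFrozen V (X (.inl v)))

theorem IsPrincipalLift.initial (hQ : IsClusterQuiver V) [∀ i j : V, Finite (i ⟶ j)] :
    IsPrincipalLift (initialSeed V) (principalSeed V) fun i => MvLaurent.var i where
  x := principalInclusion_var V
  arrows := by
    intro i j
    simp only [initialSeed, principalSeed]
    rcases hQ.no_two_cycles i j with h | h <;> simp [Nat.card_of_isEmpty]
  cluster := fun v => by
    rw [specialiseFrozen_var]
    rfl
  frozen := fun v => by
    rw [specialiseFrozen_var]
    rfl
  pos := fun v => by
    rw [specialiseFrozen_var, Sum.elim_inl]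
    exact (eval_var (fun _ => (1 : ℤˣ)) v).symm ▸ one_pos

/-- Arrow counts are positive parts of matrix entries; truncated subtraction, which cancels
2-cycles, is the positive part of the integer difference. -/
theorem toNat_mutate (p q r : ℤ) :
    (p.toNat + q.toNat * r.toNat) - ((-p).toNat + (-r).toNat * (-q).toNat) =
      (p + (max q 0 * max r 0 - max (-q) 0 * max (-r) 0)).toNat := by
  have h : p + (max q 0 * max r 0 - max (-q) 0 * max (-r) 0) =
      ((p.toNat + q.toNat * r.toNat : ℕ) : ℤ) - ((-p).toNat + (-r).toNat * (-q).toNat : ℕ) := by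
    push_cast [Int.ofNat_toNat]
    have : p = max p 0 - max (-p) 0 := by omega
    linear_combination this
  rw [h, Int.toNat_sub]

theorem IsPrincipalLift.mutate {S : Seed V (RationalFunctionField V)}
    {E : ExchangeSeed (V ⊕ V) (RationalFunctionField (V ⊕ V))} {X : V ⊕ V → MvLaurent (V ⊕ V)}
    (h : IsPrincipalLift S E X) (hE : E.IsSkew) (hEx : ∀ i, E.x i ≠ 0) {k : V}
    {f : MvLaurent (V ⊕ V)} (hf : principalInclusion V f = (E.mutate (.inl k)).x (.inl k)) :
    IsPrincipalLift (S.mutate k) (E.mutate (.inl k)) (Function.update X (.inl k) f) := by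
  have hrel : f * X (.inl k) = ∏ i : V ⊕ V, X i ^ (E.b i (.inl k)).toNat +
      ∏ i : V ⊕ V, X i ^ (-E.b i (.inl k)).toNat := by
    apply principalInclusion_injective V
    rw [map_mul, hf, h.x]
    simp only [map_add, map_prod, map_pow, h.x, ExchangeSeed.mutate, Function.update_self]
    exact div_mul_cancel₀ _ (hEx _)
  set π := specialiseFrozen V with hπ
  have hfrozen : ∀ v, π (X (.inr v)) = 1 := h.frozen
  have hrel' : π f * π (X (.inl k)) = ∏ i, π (X (.inl i)) ^ S.arrows i k +
      ∏ i, π (X (.inl i)) ^ S.arrows k i := by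
    rw [← map_mul, hrel]
    simp only [map_add, map_mul, map_prod, map_pow, Fintype.prod_sum_type, hfrozen, one_pow,
      Finset.prod_const_one, mul_one, h.arrows]
    congr 1
    refine Finset.prod_congr rfl fun i _ => ?_
    rw [hE (.inl k) (.inl i)]
  -- Setting frozen variables to `1` could in principle annihilate a cluster variable. Positivity of
  -- its value at the all-ones point excludes this, so the exchange relation can be divided after
  -- specialisation.
  have hne : laurentInclusion V (π (X (.inl k))) ≠ 0 := by
    rw [Ne, map_eq_zero_iff _ (laurentInclusion_injective V)]
    intro h0
    have := h.pos k
    rw [← hπ, h0, map_zero] at this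
    exact lt_irrefl _ this
  refine ⟨?_, ?_, ?_, ?_, ?_⟩
  · intro i
    by_cases hi : i = .inl k
    · subst hi
      rw [Function.update_self, hf]
    · rw [Function.update_of_ne hi, ExchangeSeed.mutate_x_of_ne hi, h.x]
  · intro i j
    simp only [Seed.mutate, ExchangeSeed.mutate, Sum.inl.injEq]
    split_ifs
    · rw [h.arrows, hE]
    · rw [← toNat_mutate]
      simp only [h.arrows]
      rw [hE (.inl j) (.inl i), hE (.inl j) (.inl k), hE (.inl k) (.inl i)]
  · intro v
    by_cases hv : v = k
    · subst hv
      simp only [Seed.mutate, Function.update_self, h.cluster, ← hπ]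
      rw [div_eq_iff hne, ← map_mul, hrel']
      simp only [map_add, map_prod, map_pow]
    · rw [Function.update_of_ne (by simpa using hv), ← h.cluster]
      simp [Seed.mutate, hv]
  · intro v
    rw [Function.update_of_ne (by simp)]
    exact h.frozen v
  · intro v
    by_cases hv : v = k
    · subst hv
      rw [Function.update_self]
      have h1 := congrArg (MvLaurent.eval fun _ => (1 : ℤˣ)).toRingHom hrel'
      simp only [map_mul, map_add, map_prod, map_pow] at h1
      refine pos_of_mul_pos_left ?_ (h.pos v).le
      rw [h1]
      exact add_pos (Finset.prod_pos fun i _ => pow_pos (h.pos i) _)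
        (Finset.prod_pos fun i _ => pow_pos (h.pos i) _)
    · rw [Function.update_of_ne (by simpa using hv)]
      exact h.pos v

theorem exists_principalLift (hQ : IsClusterQuiver V) [∀ i j : V, Finite (i ⟶ j)]
    {S : Seed V (RationalFunctionField V)} (hS : (initialSeed V).Reachable S) :
    ∃ (w : List (V ⊕ V)) (X : V ⊕ V → MvLaurent (V ⊕ V)), (∀ k ∈ w, k ∈ Set.range Sum.inl) ∧
      IsPrincipalLift S ((principalSeed V).mutateList w) X := by
  induction hS with
  | refl => exact ⟨[], _, by simp, IsPrincipalLift.initial hQ⟩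
  | mutate S k _ ih =>
    obtain ⟨w, X, hw, h⟩ := ih
    have hw' : ∀ l ∈ w ++ [Sum.inl k], l ∈ Set.range (Sum.inl : V → V ⊕ V) := by
      intro l hl
      rcases List.mem_append.1 hl with hl | hl
      · exact hw l hl
      · exact ⟨k, (List.mem_singleton.1 hl).symm⟩
    have hgood := (principalSeed_isGood V).mutateList hw
    -- The specialisation is defined on Laurent polynomials but not on all rational functions; the
    -- Laurent phenomenon provides the representative to which it applies.
    obtain ⟨f, hf⟩ := (ExchangeSeed.mem_laurentSubring_iff (principalInclusion_var V) _).1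
      (ExchangeSeed.laurent_phenomenon _ hw' (principalSeed_isGood V) (.inl k))
    rw [ExchangeSeed.mutateList_concat] at hf
    have h' := h.mutate hgood.skew hgood.x_ne_zero hf
    rw [← ExchangeSeed.mutateList_concat] at h'
    exact ⟨_, _, hw', h'⟩

/-- Every cluster variable is, modulo the exchange polynomial at a given vertex `a`, polynomial in
`x_a`. -/
theorem exists_eq_of_mem_clusterVariables (hQ : IsClusterQuiver V) [∀ i j : V, Finite (i ⟶ j)]
    {y : RationalFunctionField V} (hy : y ∈ clusterVariables V) (a : V) :
    ∃ g h : MvLaurent (V ⊕ V), IsPolynomialIn (.inl a) g ∧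
      y = laurentInclusion V (specialiseFrozen V
        (g + (principalSeed V).exchangePoly (.inl a) * h)) := by
  obtain ⟨S, hS, v, rfl⟩ := hy
  obtain ⟨w, X, hw, h⟩ := exists_principalLift hQ hS
  have hgood := principalSeed_isGood V
  have ha : Sum.inl a ∈ Set.range (Sum.inl : V → V ⊕ V) := ⟨a, rfl⟩
  -- Prefixing `a` to the word, read from the seed mutated at `a`, reaches the same final seed; this
  -- gives Laurentness in the adjacent cluster.
  have hmem := ExchangeSeed.laurent_phenomenon (.inl a :: w)
    (fun l hl => (List.mem_cons.1 hl).elim (fun e => e ▸ ha) (hw l)) (hgood.mutate ha) (.inl v)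
  rw [ExchangeSeed.mutateList_cons, hgood.mutate_mutate ha, ← h.x] at hmem
  obtain ⟨g, e, hg, he⟩ := ExchangeSeed.exists_eq_add_exchangePoly_mul hgood ha
    (principalInclusion_injective V) (principalInclusion_var V) hmem
  exact ⟨g, e, hg, by rw [h.cluster, he]⟩

theorem clusterAlgebra_le_of_specialise (hQ : IsClusterQuiver V) [∀ i j : V, Finite (i ⟶ j)]
    {σ : PartialLabelling V} {a : V} (ha : σ a = none)
    (hσ : ∏ v, σ.value v ^ (principalSeed V).b (.inl v) (.inl a) = -1) :
    clusterAlgebra V ≤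
      ((polynomialSubalgebra (⟨a, ha⟩ : {w : V // σ w = none})).comap σ.specialise).map
        (laurentInclusion V) := by
  refine Algebra.adjoin_le fun y hy => ?_
  obtain ⟨g, h, hg, rfl⟩ := exists_eq_of_mem_clusterVariables hQ hy a
  refine ⟨_, ?_, rfl⟩
  change σ.specialise _ ∈ polynomialSubalgebra _
  have hmono : ∀ m : V ⊕ V → ℤ, σ.specialise (specialiseFrozen V (mono m)) =
      ((∏ v, σ.value v ^ m (.inl v) : (MvLaurent {w : V // σ w = none})ˣ) :
        MvLaurent {w : V // σ w = none}) := by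
    intro m
    rw [specialiseFrozen_mono]
    exact eval_mono σ.value _
  -- The factor `1 + ŷ_a` of the exchange polynomial becomes `1 + (-1)`.
  have hP : σ.specialise (specialiseFrozen V
      ((principalSeed V).exchangePoly (.inl a))) = 0 := by
    rw [ExchangeSeed.exchangePoly, map_mul, map_mul, map_add, map_add, map_one, map_one,
      ExchangeSeed.ymono, hmono (fun i => (principalSeed V).b i (.inl a)), hσ]
    simp
  rw [map_add, map_add, map_mul, map_mul, hP, zero_mul, add_zero]
  refine map_mem_of_isPolynomialIn 
    (σ.specialise.toRingHom.comp (specialiseFrozen V))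
    _ (fun m hm => ?_) hg
  change σ.specialise (specialiseFrozen V (mono m)) ∈ _
  rw [hmono, Units.coe_prod]
  refine Subalgebra.prod_mem _ fun v _ => ?_
  unfold PartialLabelling.value
  split
  next hv =>
    have : (MvLaurent.var (⟨v, hv⟩ : {w : V // σ w = none}) ^ m (.inl v) :
        (MvLaurent {w : V // σ w = none})ˣ) =
        mono (m (.inl v) • (Pi.single ⟨v, hv⟩ 1 : {w : V // σ w = none} → ℤ)) := by
      rw [mono_eq_prod, Finset.prod_eq_single ⟨v, hv⟩]
      · simp
      · intro u _ hu
        simp [hu]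
      · simp
    rw [this]
    apply mono_mem_polynomialSubalgebra
    by_cases hva : v = a
    · subst hva
      simpa using hm
    · have : (⟨a, ha⟩ : {w : V // σ w = none}) ≠ ⟨v, hv⟩ := fun h => hva (Subtype.ext_iff.1 h).symm
      simp [this]
  next ε hv =>
    rw [← map_zpow]
    exact Subalgebra.algebraMap_mem _ _

end PrincipalCoefficients

/-! ### The labelling and the conclusion. -/

theorem PartialLabelling.value_of_eq_some {V : Type*} [DecidableEq V] {σ : PartialLabelling V}
    {v : V} {ε : ℤˣ} (h : σ v = some ε) : σ.value v =
      Units.map (algebraMap ℤ (MvLaurent {w : V // σ w = none})).toMonoidHom ε := by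
  unfold PartialLabelling.value
  split
  next h' => simp [h] at h'
  next ε' h' =>
    rw [h, Option.some_inj] at h'
    rw [h']

/-- Label `-1` exactly the chosen neighbours `nbr a` of the vertices `a ∈ A`. A chosen neighbour of
another `a' ∈ A` is not adjacent to `a`, so `nbr a` alone contributes a sign, with exponent `±1`;
adjacent vertices never both lie in `A`. -/
theorem exists_labelling {V : Type*} [Fintype V] [DecidableEq V] [Quiver V]
    [∀ i j : V, Finite (i ⟶ j)] (hQ : IsClusterQuiver V) (hmult : Quiver.IsThin V)
    (hiso : ∀ v : V, ∃ w : V, QuiverAdjacent v w) (A : Set V)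
    (hA : A.PairwiseDisjoint quiverNeighbourhood) :
    ∃ σ : PartialLabelling V, (∀ v : V, σ v = none ↔ v ∈ A) ∧
      ∀ a ∈ A, ∏ v, σ.value v ^ (principalSeed V).b (.inl v) (.inl a) = -1 := by
  classical
  choose nbr hnbr using hiso
  have hdisj : ∀ a ∈ A, ∀ a' ∈ A, ∀ u, u ∈ quiverNeighbourhood a → u ∈ quiverNeighbourhood a' →
      a = a' := by
    intro a ha a' ha' u hu hu'
    by_contra hne
    exact Set.disjoint_left.1 (hA ha ha' hne) hu hu'
  have hnotA : ∀ a ∈ A, ∀ v, QuiverAdjacent a v → v ∉ A := by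
    intro a ha v hav hv
    have := hdisj a ha v hv v (Or.inr hav) (Or.inl rfl)
    subst this
    rcases hav with h | h <;> exact (not_isEmpty_iff.2 h) (hQ.no_loops a)
  let σ : PartialLabelling V := fun v =>
    if v ∈ A then none else if ∃ a ∈ A, v = nbr a then some (-1) else some 1
  refine ⟨σ, fun v => ?_, fun a ha => ?_⟩
  · simp only [σ]
    split_ifs <;> simp_all
  have hval : σ.value (nbr a) = -1 := by
    rw [PartialLabelling.value_of_eq_some (ε := -1)]
    · ext1
      simp
    · simp only [σ]
      rw [if_neg (hnotA a ha _ (hnbr a)), if_pos ⟨a, ha, rfl⟩]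
  rw [Finset.prod_eq_single (nbr a)]
  · have hcard : ∀ i j : V, Nonempty (i ⟶ j) → Nat.card (i ⟶ j) = 1 ∧ Nat.card (j ⟶ i) = 0 := by
      intro i j h
      have := hmult i j
      have h0 : IsEmpty (j ⟶ i) :=
        (hQ.no_two_cycles i j).resolve_left (not_isEmpty_iff.2 h)
      exact ⟨Nat.card_unique, Nat.card_of_isEmpty⟩
    rw [hval]
    rcases hnbr a with h | h
    · simp [principalSeed, hcard _ _ h]
    · simp [principalSeed, hcard _ _ h]
  · intro v _ hv
    by_cases hav : QuiverAdjacent a v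
    · have h1 : σ v = some 1 := by
        simp only [σ]
        rw [if_neg (hnotA a ha v hav), if_neg]
        rintro ⟨a', ha', rfl⟩
        exact hv (congrArg nbr (hdisj a ha a' ha' _ (Or.inr hav) (Or.inr (hnbr a'))).symm)
      rw [PartialLabelling.value_of_eq_some h1, map_one, one_zpow]
    · have h1 : IsEmpty (a ⟶ v) := not_nonempty_iff.1 fun h => hav (Or.inl h)
      have h2 : IsEmpty (v ⟶ a) := not_nonempty_iff.1 fun h => hav (Or.inr h)
      simp [principalSeed]
  · simp

theorem mainTheorem3 {V : Type*} [Fintype V] [DecidableEq V] [Quiver V]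
    [∀ i j : V, Finite (i ⟶ j)]
    (hQ : IsClusterQuiver V)
    (hmult : Quiver.IsThin V)
    (hiso : ∀ v : V, ∃ w : V, QuiverAdjacent v w)
    (A : Set V)
    (hA : A.PairwiseDisjoint quiverNeighbourhood) :
    (∀ y ∈ clusterAlgebra V, ∃ f : MvLaurent V, laurentInclusion V f = y) ∧
    ∃ σ : PartialLabelling V, (∀ v : V, σ v = none ↔ v ∈ A) ∧ ∀ v ∈ A, IsPolyamorous σ v := by
  refine ⟨fun y hy => ?_, ?_⟩
  · have h : clusterAlgebra V ≤ (laurentInclusion V).range := by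
      refine Algebra.adjoin_le ?_
      rintro _ ⟨S, hS, v, rfl⟩
      obtain ⟨w, X, -, h⟩ := exists_principalLift hQ hS
      exact ⟨_, (h.cluster v).symm⟩
    exact h hy
  · obtain ⟨σ, hσ, hprod⟩ := exists_labelling hQ hmult hiso A hA
    refine ⟨σ, hσ, fun a ha => ⟨(hσ a).2 ha, ?_⟩⟩
    rintro _ ⟨f, hf, rfl⟩
    obtain ⟨g, hg, hgf⟩ := clusterAlgebra_le_of_specialise hQ ((hσ a).2 ha) (hprod a ha) hf
    rw [← laurentInclusion_injective V hgf]
    exact hg
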